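/- Let $\Phi\subseteq E$ be an irreducible reduced crystallographic root system in a finite-dimensional $\mathbb{Q}$-vector space $E$, with simple roots $\{\alpha_i\}_{i\in I}$, positive roots $\Phi^+$, Weyl group $W$ with simple reflections $s_i$, and weight lattice $\Lambda$ (the $\mathbb{Z}$-span of the fundamental weights). A weight $0\ne\lambda\in\Lambda$ is a *minuscule weight* if it is dominant and $(\lambda,\alpha^\vee)\in\{0,\pm1\}$ for all $\alpha\in\Phi$. Let $\Psi\subseteq\Lambda$ be a non-empty union of $W$-orbits of minuscule weights. For a commutative ring $R$ with $1$ let $M_R$ be the free $R$-module with basis $\{z_\mu\mid\mu\in\Psi\}$, and define $R$-linear maps $e_i,f_i\colon M_R\to M_R$ ($i\in I$) by $e_i(z_\mu)=z_{\mu+\alpha_i}$ if $(\mu,\alpha_i^\vee)=-1$ and $e_i(z_\mu)=0$ otherwise; $f_i(z_\mu)=z_{\mu-\alpha_i}$ if $(\mu,\alpha_i^\vee)=1$ and $f_i(z_\mu)=0$ otherwise. Then $e_i^2=f_i^2=0$. Put $x_i(t)=\mathrm{id}+te_i$, $y_i(t)=\mathrm{id}+tf_i$ ($t\in R$), $n_i=x_i(1)y_i(-1)x_i(1)$,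 and let $G_R(\Psi)=\langle x_i(t),y_i(t)\mid i\in I,\ t\in R\rangle\subseteq \mathrm{GL}(M_R)$. For each $\alpha\in\Phi$ choose, independently of $R$, indices $i,i_1,\dots,i_k\in I$ with $\alpha=s_{i_1}\cdots s_{i_k}(\alpha_i)$, and set $\mathbf{e}_\alpha=n_{i_1}\cdots n_{i_k}\,e_i\,n_{i_k}^{-1}\cdots n_{i_1}^{-1}$. Then $\mathbf{e}_\alpha^2=0$, and $x_\alpha(t):=\mathrm{id}+t\,\mathbf{e}_\alpha\in G_R(\Psi)$ for all $t\in R$. **Proposition.** Let $\alpha,\beta\in\Phi^+$ with $\beta\neq\pm\alpha$. If $\alpha+\beta\notin\Phi$, then $x_\alpha(t)x_\beta(u)=x_\beta(u)x_\alpha(t)$ for every commutative ring $R$ and all $t,u\in R$. If $\alpha+\beta\in\Phi$, then there is a unique scalar $c\in\mathbb{C}$ with $[\mathbf{e}_\alpha,\mathbf{e}_\beta]=c\,\mathbf{e}_{\alpha+\beta}$ over $\mathbb{C}$; it satisfies $c\in\{\pm1,\pm2\}$, and the following hold for every commutative ring $R$ and all $t,u\in R$. (a) If $2\alpha+\beta\notin\Phi$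 and $\alpha+2\beta\notin\Phi$, then $x_\beta(-u)x_\alpha(t)x_\beta(u)=x_\alpha(t)x_{\alpha+\beta}(ctu)$. (b) If $2\alpha+\beta\notin\Phi$ and $\alpha+2\beta\in\Phi$, then $$x_\beta(-u)x_\alpha(t)x_\beta(u)=x_\alpha(t)x_{\alpha+\beta}(ctu)x_{\alpha+2\beta}(-c'tu^2),$$ where the factors on the right-hand side commute with each other and $c'=\pm1$ is the unique complex scalar with $\mathbf{e}_\beta\mathbf{e}_\alpha\mathbf{e}_\beta=c'\mathbf{e}_{\alpha+2\beta}$ over $\mathbb{C}$. (c) If $2\alpha+\beta\in\Phi$, then $\alpha+2\beta\notin\Phi$ and $$x_\beta(-u)x_\alpha(t)x_\beta(u)=x_\alpha(t)x_{\alpha+\beta}(ctu)x_{2\alpha+\beta}(c''t^2u),$$ where $c''=\pm1$ is the unique complex scalar with $\mathbf{e}_\alpha\mathbf{e}_\beta\mathbf{e}_\alpha=c''\mathbf{e}_{2\alpha+\beta}$ over $\mathbb{C}$. -/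

import Mathlib

noncomputable section

namespace MinusculeChevalley

variable {ι E N : Type*} [AddCommGroup E] [Module ℚ E] [AddCommGroup N] [Module ℚ N]
  {P : RootPairing ι ℚ E N} (b : P.Base)

/-- `ϖ` is the fundamental weight attached to the simple root `i`:
`(ϖ, αⱼ^∨) = δᵢⱼ` for all simple roots `αⱼ`. -/
def IsFundamentalWeight (i : b.support) (ϖ : E) : Prop :=
  (P.coroot' i ϖ = 1) ∧ ∀ j : b.support, j ≠ i → P.coroot' j ϖ = 0

/-- The weight lattice: the `ℤ`-span of the fundamental weights. -/
def weightLattice : Submodule ℤ E :=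
  Submodule.span ℤ {ϖ : E | ∃ i : b.support, IsFundamentalWeight b i ϖ}

/-- Minuscule weights: nonzero dominant elements `v` of the weight lattice such that
`(v, α^∨) ∈ {0, ±1}` for every root `α`. -/
structure IsMinuscule (v : E) : Prop where
  mem_weightLattice : v ∈ weightLattice b
  ne_zero : v ≠ 0
  dominant : ∀ i : b.support, 0 ≤ P.coroot' i v
  coroot_mem : ∀ a : ι, P.coroot' a v ∈ ({0, 1, -1} : Set ℚ)

/-- A set `Ψ` of weights which is a non-empty union of Weyl group orbits of minuscule weights. -/
structure MinusculeSet where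
  carrier : Set E
  isUnion : ∃ S : Set E, S.Nonempty ∧ (∀ v ∈ S, IsMinuscule b v) ∧
    carrier = ⋃ v ∈ S, MulAction.orbit P.weylGroup v

namespace MinusculeSet

variable {b} (Ψ : MinusculeSet b)

/-- `Ψ` is stable under the simple reflections. -/
theorem reflection_mem {μ : E} (h : μ ∈ Ψ.carrier) (i : b.support) :
    P.reflection i μ ∈ Ψ.carrier := by
  obtain ⟨S, -, -, hS⟩ := Ψ.isUnion
  rw [hS] at h ⊢
  simp only [Set.mem_iUnion] at h ⊢
  obtain ⟨v, hv, hμ⟩ := h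
  obtain ⟨g, rfl⟩ := hμ
  exact ⟨v, hv, RootPairing.weylGroup.ofIdx P i * g, by
    simp only [mul_smul, RootPairing.weylGroup.ofIdx_smul]; rfl⟩

/-- If `(μ, αᵢ^∨) = -1` then `μ + αᵢ ∈ Ψ`. -/
theorem add_mem {μ : E} (h : μ ∈ Ψ.carrier) (i : b.support) (hi : P.coroot' i μ = -1) :
    μ + P.root i ∈ Ψ.carrier := by
  simpa [RootPairing.reflection_apply, hi] using Ψ.reflection_mem h i

/-- If `(μ, αᵢ^∨) = 1` then `μ - αᵢ ∈ Ψ`. -/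
theorem sub_mem {μ : E} (h : μ ∈ Ψ.carrier) (i : b.support) (hi : P.coroot' i μ = 1) :
    μ - P.root i ∈ Ψ.carrier := by
  simpa [RootPairing.reflection_apply, hi] using Ψ.reflection_mem h i

section Ring

variable (R : Type*) [CommRing R]

/-- The free `R`-module with basis `z_μ` (`μ ∈ Ψ`), where `z_μ = Finsupp.single μ 1`. -/
abbrev FreeMod : Type _ := Ψ.carrier →₀ R

open Classical in
/-- The map `eᵢ`: `z_μ ↦ z_{μ + αᵢ}` if `(μ, αᵢ^∨) = -1`, and `z_μ ↦ 0` otherwise. -/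
def e (i : b.support) : Module.End R (Ψ.FreeMod R) :=
  Finsupp.linearCombination R fun μ : Ψ.carrier =>
    if h : P.coroot' i (μ : E) = -1 then
      Finsupp.single (⟨(μ : E) + P.root i, Ψ.add_mem μ.2 i h⟩ : Ψ.carrier) (1 : R)
    else 0

open Classical in
/-- The map `fᵢ`: `z_μ ↦ z_{μ - αᵢ}` if `(μ, αᵢ^∨) = 1`, and `z_μ ↦ 0` otherwise. -/
def f (i : b.support) : Module.End R (Ψ.FreeMod R) :=
  Finsupp.linearCombination R fun μ : Ψ.carrier =>
    if h : P.coroot' i (μ : E) = 1 then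
      Finsupp.single (⟨(μ : E) - P.root i, Ψ.sub_mem μ.2 i h⟩ : Ψ.carrier) (1 : R)
    else 0

theorem e_mul_e (i : b.support) : Ψ.e R i * Ψ.e R i = 0 := by
  classical
  refine Finsupp.lhom_ext' fun μ => LinearMap.ext_ring ?_
  by_cases h : P.coroot' i (μ : E) = -1
  · have h2 : ¬ P.coroot' i ((μ : E) + P.root i) = -1 := by
      rw [map_add, h]; norm_num
    simp only [e, Module.End.mul_apply, LinearMap.comp_apply, Finsupp.lsingle_apply,
      Finsupp.linearCombination_single, one_smul, dif_pos h, dif_neg h2, LinearMap.zero_apply]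
  · simp only [e, Module.End.mul_apply, LinearMap.comp_apply, Finsupp.lsingle_apply,
      Finsupp.linearCombination_single, one_smul, dif_neg h, map_zero, LinearMap.zero_apply]

theorem f_mul_f (i : b.support) : Ψ.f R i * Ψ.f R i = 0 := by
  classical
  refine Finsupp.lhom_ext' fun μ => LinearMap.ext_ring ?_
  by_cases h : P.coroot' i (μ : E) = 1
  · have h2 : ¬ P.coroot' i ((μ : E) - P.root i) = 1 := by
      rw [map_sub, h]; norm_num
    simp only [f, Module.End.mul_apply, LinearMap.comp_apply, Finsupp.lsingle_apply,
      Finsupp.linearCombination_single, one_smul, dif_pos h, dif_neg h2, LinearMap.zero_apply]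
  · simp only [f, Module.End.mul_apply, LinearMap.comp_apply, Finsupp.lsingle_apply,
      Finsupp.linearCombination_single, one_smul, dif_neg h, map_zero, LinearMap.zero_apply]

end Ring

/-- For `x` with `x² = 0`, the invertible map `id + t x`, with inverse `id - t x`. -/
def unipotent {R : Type*} [CommRing R] {V : Type*} [AddCommGroup V] [Module R V]
    (x : Module.End R V) (hx : x * x = 0) (t : R) : LinearMap.GeneralLinearGroup R V where
  val := 1 + t • x
  inv := 1 - t • x
  val_inv := by simp [mul_sub, add_mul, hx]
  inv_val := by simp [sub_mul, mul_add, hx]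

variable (R : Type*) [CommRing R]

/-- `xᵢ(t) = id + t eᵢ`. -/
def x (i : b.support) (t : R) : LinearMap.GeneralLinearGroup R (Ψ.FreeMod R) :=
  unipotent (Ψ.e R i) (Ψ.e_mul_e R i) t

/-- `yᵢ(t) = id + t fᵢ`. -/
def y (i : b.support) (t : R) : LinearMap.GeneralLinearGroup R (Ψ.FreeMod R) :=
  unipotent (Ψ.f R i) (Ψ.f_mul_f R i) t

/-- The Chevalley group `G_R(Ψ) = ⟨xᵢ(t), yᵢ(t) ∣ i ∈ I, t ∈ R⟩`. -/
def chevalleyGroup : Subgroup (LinearMap.GeneralLinearGroup R (Ψ.FreeMod R)) :=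
  Subgroup.closure {g | ∃ (i : b.support) (t : R), g = Ψ.x R i t ∨ g = Ψ.y R i t}

/-- `nᵢ = xᵢ(1) yᵢ(-1) xᵢ(1)`. -/
def n (i : b.support) : LinearMap.GeneralLinearGroup R (Ψ.FreeMod R) :=
  Ψ.x R i 1 * Ψ.y R i (-1) * Ψ.x R i 1

end MinusculeSet

/-- A choice, for every root `α`, of simple roots `αᵢ` and `αᵢ₁, …, αᵢₖ` such that
`α = sᵢ₁ ⋯ sᵢₖ (αᵢ)`. -/
structure RootWords where
  word : ι → List b.support
  simple : ι → b.support
  root_eq : ∀ a : ι, P.root a =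
    ((word a).map fun j : b.support => P.reflection (j : ι)).prod (P.root (simple a))

namespace MinusculeSet

variable {b} (Ψ : MinusculeSet b) (W : RootWords b) (R : Type*) [CommRing R]

/-- The product `nᵢ₁ ⋯ nᵢₖ` along the word chosen for the root `α`. -/
def nWord (a : ι) : LinearMap.GeneralLinearGroup R (Ψ.FreeMod R) :=
  ((W.word a).map (Ψ.n R)).prod

/-- The root element `𝐞_α = nᵢ₁ ⋯ nᵢₖ eᵢ nᵢₖ⁻¹ ⋯ nᵢ₁⁻¹`. Over `R = ℂ` this is an element of
`𝔤𝔩(M)`. The defining formula makes sense over `ℤ` and is compatible with base change, so that over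
a general ring `R` it is the map induced by `𝐞_α` on `R ⊗ M_ℤ`. -/
def rootVector (a : ι) : Module.End R (Ψ.FreeMod R) :=
  (Ψ.nWord W R a : Module.End R (Ψ.FreeMod R)) * Ψ.e R (W.simple a) *
    ((Ψ.nWord W R a)⁻¹ : LinearMap.GeneralLinearGroup R (Ψ.FreeMod R))

theorem rootVector_mul_self (a : ι) : Ψ.rootVector W R a * Ψ.rootVector W R a = 0 := by
  simp only [rootVector, mul_assoc, Units.inv_mul_cancel_left]
  rw [← mul_assoc (Ψ.e R _), e_mul_e, zero_mul, mul_zero]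

theorem n_mem (i : b.support) : Ψ.n R i ∈ Ψ.chevalleyGroup R :=
  mul_mem (mul_mem (Subgroup.subset_closure ⟨i, 1, Or.inl rfl⟩)
    (Subgroup.subset_closure ⟨i, -1, Or.inr rfl⟩)) (Subgroup.subset_closure ⟨i, 1, Or.inl rfl⟩)

theorem nWord_mem (a : ι) : Ψ.nWord W R a ∈ Ψ.chevalleyGroup R := by
  refine Subgroup.list_prod_mem _ fun g hg => ?_
  obtain ⟨i, -, rfl⟩ := List.mem_map.mp hg
  exact Ψ.n_mem R i

theorem unipotent_rootVector_eq (a : ι) (t : R) :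
    unipotent (Ψ.rootVector W R a) (Ψ.rootVector_mul_self W R a) t =
      Ψ.nWord W R a * Ψ.x R (W.simple a) t * (Ψ.nWord W R a)⁻¹ := by
  ext1
  simp only [unipotent, rootVector, x, Units.val_mul, mul_add, add_mul, mul_one,
    Units.mul_inv, Algebra.mul_smul_comm, Algebra.smul_mul_assoc]

/-- `x_α(t) = id + t 𝐞_α`, as an element of the Chevalley group `G_R(Ψ)`. -/
def xRoot (a : ι) (t : R) : Ψ.chevalleyGroup R :=
  ⟨unipotent (Ψ.rootVector W R a) (Ψ.rootVector_mul_self W R a) t, by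
    rw [unipotent_rootVector_eq]
    exact mul_mem (mul_mem (Ψ.nWord_mem W R a) (Subgroup.subset_closure ⟨_, t, Or.inl rfl⟩))
      (inv_mem (Ψ.nWord_mem W R a))⟩

end MinusculeSet

end MinusculeChevalley

end

/-! Over any ring, `𝐞_α` sends `z_v` to `±z_{v+α}` when `(v, α^∨) = -1` and kills it otherwise,
because each `nᵢ` permutes the basis up to signs as `sᵢ` does (`actsAsRoot_rootVector`). Write `a`,
`b` for `𝐞_α`, `𝐞_β`. Since `a² = b² = 0`, the conjugate `x_β(-u) x_α(t) x_β(u)` equals `1 + ta +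
tu(ab - ba) - tu²·bab`, so every formula reduces to evaluating `ab - ba`, `aba` and `bab`.

That these are multiples of root vectors is shown over `ℚ`. The span `lieSpan` of iterated brackets
of the `eᵢ`, of the `fᵢ`, and of diagonal operators is stable under `ad eᵢ` and `ad fᵢ`. Conjugation
by `1 + eᵢ` is `exp(ad eᵢ)`, hence `lieSpan` is stable under conjugation by `nᵢ` and under `ad 𝐞_α`.
Its elements of weight `αᵢ` are multiples of `eᵢ`, and conjugation carries this to every root
(`eq_smul_rootEnd_of_hasWeight`). A nonzero element whose weight is a nonempty sum of simple roots
has a root as weight (`listWeight_mem_range_of_ne_zero`), which gives the commuting case.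

The scalars come from evaluation at one `z_v` with `v` pairing to `-1` with the target root. The
value `±2` occurs for orthogonal roots whose sum is a root, and is derived from the other two cases.
Minuscule weights exclude `G₂`, so few rank two configurations remain. All operators are defined
over `ℤ`, and `M_ℤ` embeds in `M_ℚ`; identities with integer scalars therefore pass from `ℚ` to `ℤ`
and then to every ring. -/

noncomputable section

namespace MinusculeChevalley

variable {ι E N : Type*} [AddCommGroup E] [Module ℚ E] [AddCommGroup N] [Module ℚ N]
  {P : RootPairing ι ℚ E N}

namespace MinusculeSet

/-! ### Action of `eᵢ`, `fᵢ`, `nᵢ` and `𝐞_α` on the weight basis. -/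

section WeightBasis

variable {b : P.Base} (Ψ : MinusculeSet b)

theorem reflection_mem_of_root {v : E} (h : v ∈ Ψ.carrier) (a : ι) :
    P.reflection a v ∈ Ψ.carrier := by
  obtain ⟨S, -, -, hS⟩ := Ψ.isUnion
  rw [hS] at h ⊢
  simp only [Set.mem_iUnion] at h ⊢
  obtain ⟨w, hw, g, rfl⟩ := h
  exact ⟨w, hw, RootPairing.weylGroup.ofIdx P a * g, by
    simp only [mul_smul, RootPairing.weylGroup.ofIdx_smul]; rfl⟩

theorem coroot'_mem {v : E} (h : v ∈ Ψ.carrier) (a : ι) :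
    P.coroot' a v ∈ ({0, 1, -1} : Set ℚ) := by
  obtain ⟨S, -, hmin, hS⟩ := Ψ.isUnion
  rw [hS] at h
  simp only [Set.mem_iUnion] at h
  obtain ⟨w, hw, ⟨g, hg⟩, rfl⟩ := h
  -- The bound is required for all coroots at once, since a reflection permutes them; this form
  -- survives induction over the Weyl group.
  have key : ∀ u : E, (∀ a, P.coroot' a u ∈ ({0, 1, -1} : Set ℚ)) →
      ∀ a, P.coroot' a (g • u) ∈ ({0, 1, -1} : Set ℚ) := by
    induction hg using RootPairing.weylGroup.induction with
    | mem i =>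
      intro u hu a
      have : RootPairing.Equiv.reflection P i • u = P.reflection i u := rfl
      rw [this, P.coroot'_reflection]
      exact hu _
    | one => intro u hu a; simpa using hu a
    | mul x y _ _ hx hy =>
      intro u hu a
      rw [mul_smul]
      exact hx _ (hy _ hu) a
  exact key w (hmin w hw).coroot_mem a

theorem coroot'_cases {v : E} (h : v ∈ Ψ.carrier) (a : ι) :
    P.coroot' a v = 0 ∨ P.coroot' a v = 1 ∨ P.coroot' a v = -1 := Ψ.coroot'_mem h a

theorem reflection_of_neg_one {v : E} {a : ι} (h : P.coroot' a v = -1) :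
    P.reflection a v = v + P.root a := by
  rw [P.reflection_apply, h]; module

theorem reflection_of_one {v : E} {a : ι} (h : P.coroot' a v = 1) :
    P.reflection a v = v - P.root a := by
  rw [P.reflection_apply, h]; module

theorem reflection_of_zero {v : E} {a : ι} (h : P.coroot' a v = 0) :
    P.reflection a v = v := by
  rw [P.reflection_apply, h]; module

theorem add_root_mem {v : E} (h : v ∈ Ψ.carrier) {a : ι} (ha : P.coroot' a v = -1) :
    v + P.root a ∈ Ψ.carrier :=
  reflection_of_neg_one ha ▸ Ψ.reflection_mem_of_root h a

theorem coroot'_root_self (a : ι) : P.coroot' a (P.root a) = 2 := P.root_coroot_two a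

variable (R : Type*) [CommRing R]

/-- The module `M_R`, with its module structure coming from that of an additive group. -/
def Mod : Type _ := Ψ.carrier →₀ R

instance : AddCommGroup (Ψ.Mod R) := inferInstanceAs (AddCommGroup (Ψ.carrier →₀ R))

instance : Module R (Ψ.Mod R) := inferInstanceAs (Module R (Ψ.carrier →₀ R))

/-- `eᵢ` as an endomorphism of `Ψ.Mod R`. -/
def eEnd (i : b.support) : Module.End R (Ψ.Mod R) := Ψ.e R i

/-- `fᵢ` as an endomorphism of `Ψ.Mod R`. -/
def fEnd (i : b.support) : Module.End R (Ψ.Mod R) := Ψ.f R i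

/-- `nᵢ` as a unit of the endomorphism ring of `Ψ.Mod R`. -/
def nUnit (i : b.support) : (Module.End R (Ψ.Mod R))ˣ := Ψ.n R i

/-- `𝐞_α` as an endomorphism of `Ψ.Mod R`. -/
def rootEnd (W : RootWords b) (a : ι) : Module.End R (Ψ.Mod R) := Ψ.rootVector W R a

theorem rootEnd_eq (W : RootWords b) (a : ι) : Ψ.rootEnd R W a =
    ((W.word a).map (Ψ.nUnit R)).prod.val * Ψ.eEnd R (W.simple a) *
      ((W.word a).map (Ψ.nUnit R)).prod⁻¹.val := rfl

theorem rootEnd_mul_self (W : RootWords b) (a : ι) :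
    Ψ.rootEnd R W a * Ψ.rootEnd R W a = 0 := Ψ.rootVector_mul_self W R a

theorem eEnd_mul_self (i : b.support) : Ψ.eEnd R i * Ψ.eEnd R i = 0 := Ψ.e_mul_e R i

theorem fEnd_mul_self (i : b.support) : Ψ.fEnd R i * Ψ.fEnd R i = 0 := Ψ.f_mul_f R i

open Classical in
/-- The basis vector `z_v` for `v ∈ Ψ`, extended by zero to all `v`. -/
def zvec (v : E) : Ψ.Mod R :=
  if h : v ∈ Ψ.carrier then (Finsupp.single ⟨v, h⟩ 1 : Ψ.carrier →₀ R) else (0 : Ψ.carrier →₀ R)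

theorem zvec_of_mem {v : E} (h : v ∈ Ψ.carrier) :
    Ψ.zvec R v = (Finsupp.single ⟨v, h⟩ 1 : Ψ.carrier →₀ R) := dif_pos h

theorem zvec_of_notMem {v : E} (h : v ∉ Ψ.carrier) : Ψ.zvec R v = 0 := dif_neg h

/-- The coefficient of `z_w`, for `w ∈ Ψ`. -/
def coord (w : Ψ.carrier) : Ψ.Mod R →ₗ[R] R := Finsupp.lapply (M := R) (R := R) w

theorem coord_zvec_self (w : Ψ.carrier) : Ψ.coord R w (Ψ.zvec R w) = 1 := by
  rw [zvec_of_mem _ _ w.2]; exact Finsupp.single_eq_same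

theorem coord_zvec_of_ne {v : E} {w : Ψ.carrier} (h : v ≠ w) :
    Ψ.coord R w (Ψ.zvec R v) = 0 := by
  by_cases hv : v ∈ Ψ.carrier
  · rw [zvec_of_mem _ _ hv]
    exact Finsupp.single_eq_of_ne fun e => h (congrArg Subtype.val e).symm
  · rw [zvec_of_notMem _ _ hv, map_zero]

theorem zvec_ne_zero [Nontrivial R] {v : E} (h : v ∈ Ψ.carrier) : Ψ.zvec R v ≠ 0 := fun h0 => by
  simpa [h0] using Ψ.coord_zvec_self R ⟨v, h⟩

variable {R} in
theorem end_ext {x y : Module.End R (Ψ.Mod R)}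
    (h : ∀ v ∈ Ψ.carrier, x (Ψ.zvec R v) = y (Ψ.zvec R v)) : x = y := by
  refine Finsupp.lhom_ext' (M := R) (R := R) fun μ => LinearMap.ext_ring ?_
  have := h μ μ.2
  rwa [zvec_of_mem _ _ μ.2] at this

theorem e_zvec {v : E} (h : v ∈ Ψ.carrier) (i : b.support) (hi : P.coroot' i v = -1) :
    Ψ.eEnd R i (Ψ.zvec R v) = Ψ.zvec R (v + P.root i) := by
  rw [zvec_of_mem _ _ h, zvec_of_mem _ _ (Ψ.add_mem h i hi)]
  change Ψ.e R i _ = _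
  rw [e, Finsupp.linearCombination_single, one_smul, dif_pos hi]

theorem e_zvec_of_ne {v : E} (h : v ∈ Ψ.carrier) (i : b.support) (hi : P.coroot' i v ≠ -1) :
    Ψ.eEnd R i (Ψ.zvec R v) = 0 := by
  rw [zvec_of_mem _ _ h]
  change Ψ.e R i _ = _
  rw [e, Finsupp.linearCombination_single, one_smul, dif_neg hi]
  rfl

theorem f_zvec {v : E} (h : v ∈ Ψ.carrier) (i : b.support) (hi : P.coroot' i v = 1) :
    Ψ.fEnd R i (Ψ.zvec R v) = Ψ.zvec R (v - P.root i) := by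
  rw [zvec_of_mem _ _ h, zvec_of_mem _ _ (Ψ.sub_mem h i hi)]
  change Ψ.f R i _ = _
  rw [f, Finsupp.linearCombination_single, one_smul, dif_pos hi]

theorem f_zvec_of_ne {v : E} (h : v ∈ Ψ.carrier) (i : b.support) (hi : P.coroot' i v ≠ 1) :
    Ψ.fEnd R i (Ψ.zvec R v) = 0 := by
  rw [zvec_of_mem _ _ h]
  change Ψ.f R i _ = _
  rw [f, Finsupp.linearCombination_single, one_smul, dif_neg hi]
  rfl

/-- `id + t x` for `x² = 0`, as a unit of the endomorphism ring of `Ψ.Mod R`. -/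
def unip (x : Module.End R (Ψ.Mod R)) (hx : x * x = 0) (t : R) : (Module.End R (Ψ.Mod R))ˣ :=
  unipotent x hx t

theorem unip_val (x : Module.End R (Ψ.Mod R)) (hx : x * x = 0) (t : R) :
    (Ψ.unip R x hx t).val = 1 + t • x := rfl

theorem unip_inv_val (x : Module.End R (Ψ.Mod R)) (hx : x * x = 0) (t : R) :
    (Ψ.unip R x hx t)⁻¹.val = 1 - t • x := rfl

theorem nUnit_eq (i : b.support) : Ψ.nUnit R i =
    Ψ.unip R (Ψ.eEnd R i) (Ψ.eEnd_mul_self R i) 1 *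
    Ψ.unip R (Ψ.fEnd R i) (Ψ.fEnd_mul_self R i) (-1) *
    Ψ.unip R (Ψ.eEnd R i) (Ψ.eEnd_mul_self R i) 1 := rfl

theorem n_val (i : b.support) : (Ψ.nUnit R i).val =
    (1 + Ψ.eEnd R i) * (1 - Ψ.fEnd R i) * (1 + Ψ.eEnd R i) := by
  simp [nUnit_eq, unip_val, sub_eq_add_neg]

theorem n_inv_val (i : b.support) : (Ψ.nUnit R i)⁻¹.val =
    (1 - Ψ.eEnd R i) * (1 + Ψ.fEnd R i) * (1 - Ψ.eEnd R i) := by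
  simp [nUnit_eq, unip_inv_val, sub_eq_add_neg, mul_assoc]

/-- Each `αᵢ`-string in `Ψ` has one or two elements, so `nᵢ` acts there trivially or as the matrix
of `SL₂` that swaps the two basis vectors up to a sign. -/
theorem n_zvec {v : E} (h : v ∈ Ψ.carrier) (i : b.support) :
    ∃ ε : R, (ε = 1 ∨ ε = -1) ∧
      (Ψ.nUnit R i).val (Ψ.zvec R v) = ε • Ψ.zvec R (P.reflection i v) := by
  have h2 := coroot'_root_self (P := P) (i : ι)
  rcases Ψ.coroot'_cases h i with hi | hi | hi
  · refine ⟨1, Or.inl rfl, ?_⟩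
    rw [n_val, reflection_of_zero hi]
    simp [Ψ.e_zvec_of_ne R h i (by rw [hi]; norm_num),
      Ψ.f_zvec_of_ne R h i (by rw [hi]; norm_num)]
  · refine ⟨-1, Or.inr rfl, ?_⟩
    have hm := Ψ.sub_mem h i hi
    have hc : P.coroot' i (v - P.root i) = -1 := by rw [map_sub, hi, h2]; norm_num
    have he := Ψ.e_zvec R hm i hc
    rw [sub_add_cancel] at he
    rw [n_val, reflection_of_one hi]
    simp [Ψ.e_zvec_of_ne R h i (by rw [hi]; norm_num), Ψ.f_zvec R h i hi, he]
    abel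
  · refine ⟨1, Or.inl rfl, ?_⟩
    have hm := Ψ.add_mem h i hi
    have hc : P.coroot' i (v + P.root i) = 1 := by rw [map_add, hi, h2]; norm_num
    have hf := Ψ.f_zvec R hm i hc
    rw [add_sub_cancel_right] at hf
    rw [n_val, reflection_of_neg_one hi]
    simp [Ψ.e_zvec R h i hi, hf, Ψ.f_zvec_of_ne R h i (by rw [hi]; norm_num),
      Ψ.e_zvec_of_ne R hm i (by rw [hc]; norm_num)]

theorem n_inv_zvec {v : E} (h : v ∈ Ψ.carrier) (i : b.support) :
    ∃ ε : R, (ε = 1 ∨ ε = -1) ∧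
      (Ψ.nUnit R i)⁻¹.val (Ψ.zvec R v) = ε • Ψ.zvec R (P.reflection i v) := by
  obtain ⟨ε, hε, he⟩ := Ψ.n_zvec R (Ψ.reflection_mem h i) i
  refine ⟨ε, hε, ?_⟩
  rw [P.reflection_same] at he
  have hεε : ε * ε = 1 := by rcases hε with rfl | rfl <;> simp
  have := congrArg (Ψ.nUnit R i)⁻¹.val he
  rw [← Module.End.mul_apply, Units.inv_mul, Module.End.one_apply, map_smul] at this
  rw [this, smul_smul, hεε, one_smul]

/-- `x` has weight `γ`: it maps the weight space of `v` into that of `v + γ`. -/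
def HasWeight (γ : E) : Submodule R (Module.End R (Ψ.Mod R)) where
  carrier := {x | ∀ v ∈ Ψ.carrier, ∃ c : R, x (Ψ.zvec R v) = c • Ψ.zvec R (v + γ)}
  add_mem' := by
    intro x y hx hy v hv
    obtain ⟨c, hc⟩ := hx v hv
    obtain ⟨d, hd⟩ := hy v hv
    exact ⟨c + d, by rw [LinearMap.add_apply, hc, hd, add_smul]⟩
  zero_mem' := fun v _ => ⟨0, by simp⟩
  smul_mem' := by
    intro r x hx v hv
    obtain ⟨c, hc⟩ := hx v hv
    exact ⟨r * c, by rw [LinearMap.smul_apply, hc, smul_smul]⟩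

variable {R}

theorem HasWeight.mul {x y : Module.End R (Ψ.Mod R)} {γ δ : E}
    (hx : x ∈ Ψ.HasWeight R γ) (hy : y ∈ Ψ.HasWeight R δ) :
    x * y ∈ Ψ.HasWeight R (γ + δ) := by
  intro v hv
  obtain ⟨d, hd⟩ := hy v hv
  rw [Module.End.mul_apply, hd, map_smul]
  by_cases hm : v + δ ∈ Ψ.carrier
  · obtain ⟨c, hc⟩ := hx _ hm
    refine ⟨d * c, ?_⟩
    rw [hc, smul_smul, add_assoc, add_comm δ γ]
  · exact ⟨0, by simp [zvec_of_notMem _ _ hm]⟩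

/-- Weights add under composition in either order; `zvec` being zero off `Ψ` covers the strings that
leave `Ψ`. -/
theorem HasWeight.lie {x y : Module.End R (Ψ.Mod R)} {γ δ : E}
    (hx : x ∈ Ψ.HasWeight R γ) (hy : y ∈ Ψ.HasWeight R δ) :
    ⁅x, y⁆ ∈ Ψ.HasWeight R (γ + δ) := by
  rw [Ring.lie_def]
  exact _root_.sub_mem (HasWeight.mul Ψ hx hy) (add_comm δ γ ▸ HasWeight.mul Ψ hy hx)

theorem e_hasWeight (i : b.support) : Ψ.eEnd R i ∈ Ψ.HasWeight R (P.root i) := by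
  intro v hv
  by_cases hi : P.coroot' i v = -1
  · exact ⟨1, by rw [Ψ.e_zvec R hv i hi, one_smul]⟩
  · exact ⟨0, by rw [Ψ.e_zvec_of_ne R hv i hi, zero_smul]⟩

theorem f_hasWeight (i : b.support) : Ψ.fEnd R i ∈ Ψ.HasWeight R (-P.root i) := by
  intro v hv
  by_cases hi : P.coroot' i v = 1
  · exact ⟨1, by rw [Ψ.f_zvec R hv i hi, one_smul, sub_eq_add_neg]⟩
  · exact ⟨0, by rw [Ψ.f_zvec_of_ne R hv i hi, zero_smul]⟩

theorem HasWeight.conj_n_inv {x : Module.End R (Ψ.Mod R)} {γ : E}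
    (hx : x ∈ Ψ.HasWeight R γ) (i : b.support) :
    (Ψ.nUnit R i)⁻¹.val * x * (Ψ.nUnit R i).val ∈ Ψ.HasWeight R (P.reflection i γ) := by
  intro v hv
  obtain ⟨ε, -, he⟩ := Ψ.n_zvec R hv i
  obtain ⟨c, hc⟩ := hx _ (Ψ.reflection_mem hv i)
  rw [Module.End.mul_apply, he, map_smul, Module.End.mul_apply, hc, map_smul]
  by_cases hm : P.reflection i v + γ ∈ Ψ.carrier
  · obtain ⟨ε', -, he'⟩ := Ψ.n_inv_zvec R hm i
    rw [he', map_add, P.reflection_same]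
    exact ⟨ε * (c * ε'), by simp only [smul_smul]⟩
  · exact ⟨0, by simp [zvec_of_notMem _ _ hm]⟩

/-- `x` acts like a root vector for the root `a`: it sends `z_v` to `±z_{v + a}` if
`(v, a^∨) = -1` and kills it otherwise. -/
def ActsAsRoot (x : Module.End R (Ψ.Mod R)) (a : ι) : Prop :=
  ∀ v ∈ Ψ.carrier,
    (P.coroot' a v = -1 → ∃ ε : R, (ε = 1 ∨ ε = -1) ∧
      x (Ψ.zvec R v) = ε • Ψ.zvec R (v + P.root a)) ∧
    (P.coroot' a v ≠ -1 → x (Ψ.zvec R v) = 0)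

theorem actsAsRoot_e (i : b.support) : Ψ.ActsAsRoot (Ψ.eEnd R i) i := fun _ hv =>
  ⟨fun hi => ⟨1, Or.inl rfl, by rw [Ψ.e_zvec R hv i hi, one_smul]⟩, Ψ.e_zvec_of_ne R hv i⟩

theorem ActsAsRoot.conj_n {x : Module.End R (Ψ.Mod R)} {a : ι} (hx : Ψ.ActsAsRoot x a)
    (i : b.support) :
    Ψ.ActsAsRoot ((Ψ.nUnit R i).val * x * (Ψ.nUnit R i)⁻¹.val) (P.reflectionPerm i a) := by
  intro v hv
  obtain ⟨ε, hε, he⟩ := Ψ.n_inv_zvec R hv i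
  have hr := Ψ.reflection_mem hv i
  obtain ⟨h1, h2⟩ := hx _ hr
  rw [P.coroot'_reflection] at h1 h2
  refine ⟨fun h => ?_, fun h => ?_⟩
  · obtain ⟨ε₁, hε₁, he₁⟩ := h1 h
    have hm : P.reflection i v + P.root a ∈ Ψ.carrier :=
      Ψ.add_root_mem hr (by rw [P.coroot'_reflection]; exact h)
    obtain ⟨ε₂, hε₂, he₂⟩ := Ψ.n_zvec R hm i
    refine ⟨ε * (ε₁ * ε₂), ?_, ?_⟩
    · rcases hε with rfl | rfl <;> rcases hε₁ with rfl | rfl <;> rcases hε₂ with rfl | rfl <;>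
        simp
    · rw [Module.End.mul_apply, he, map_smul, Module.End.mul_apply, he₁, map_smul, he₂, map_add,
        P.reflection_same, P.root_reflectionPerm]
      simp only [smul_smul]
  · rw [Module.End.mul_apply, he, map_smul, Module.End.mul_apply, h2 h, map_zero, smul_zero]

theorem ActsAsRoot.hasWeight {x : Module.End R (Ψ.Mod R)} {a : ι} (hx : Ψ.ActsAsRoot x a) :
    x ∈ Ψ.HasWeight R (P.root a) := by
  intro v hv
  by_cases h : P.coroot' a v = -1
  · obtain ⟨ε, -, he⟩ := (hx v hv).1 h
    exact ⟨ε, he⟩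
  · exact ⟨0, by rw [(hx v hv).2 h, zero_smul]⟩

theorem actsAsRoot_rootVector (W : RootWords b) (a : ι) :
    Ψ.ActsAsRoot (Ψ.rootEnd R W a) a := by
  -- The root varies with the word: deleting the first letter `j` replaces `c` by `s_j(c)`.
  suffices key : ∀ (l : List b.support) (i : b.support) (c : ι),
      P.root c = (l.map fun j : b.support => P.reflection (j : ι)).prod (P.root i) →
      Ψ.ActsAsRoot ((l.map (Ψ.nUnit R)).prod.val * Ψ.eEnd R i * (l.map (Ψ.nUnit R)).prod⁻¹.val) c from
    key _ _ _ (W.root_eq a)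
  intro l i
  induction l with
  | nil =>
    intro c hc
    have : c = i := P.root.injective (by simpa using hc)
    subst this
    simpa using! Ψ.actsAsRoot_e i
  | cons j l ih =>
    intro c hc
    have h1 := ih (P.reflectionPerm j c) (by
      rw [P.root_reflectionPerm, hc]
      simp [P.reflection_same])
    have h2 := h1.conj_n Ψ j
    rw [P.reflectionPerm_self] at h2
    simpa [mul_assoc] using! h2

end WeightBasis

end MinusculeSet

attribute [local instance] LieRing.ofAssociativeRing

/-! ### A triangular decomposition stable under the generators. -/

section Triangular

variable {K L I : Type*} [Field K] [LieRing L] [LieAlgebra K L]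

/-- The left-normed bracket `[e_{j₁}, [e_{j₂}, …, [e_{jₖ}, e_i]]]`. -/
def leftMonomial (e : I → L) (i : I) : List I → L
  | [] => e i
  | j :: l => ⁅e j, leftMonomial e i l⁆

variable (K) in
/-- The span of the left-normed brackets of a family. -/
def monomialSpan (e : I → L) : Submodule K L :=
  Submodule.span K (Set.range fun p : I × List I => leftMonomial e p.1 p.2)

theorem leftMonomial_mem (e : I → L) (i : I) (l : List I) :
    leftMonomial e i l ∈ monomialSpan K e := Submodule.subset_span ⟨(i, l), rfl⟩

theorem lie_mem_monomialSpan (e : I → L) (j : I) {x : L} (hx : x ∈ monomialSpan K e) :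
    ⁅e j, x⁆ ∈ monomialSpan K e := by
  induction hx using Submodule.span_induction with
  | mem x hx =>
    obtain ⟨p, rfl⟩ := hx
    exact leftMonomial_mem e p.1 (j :: p.2)
  | zero => simp
  | add x y _ _ hx hy => rw [lie_add]; exact add_mem hx hy
  | smul c x _ hx => rw [lie_smul]; exact Submodule.smul_mem _ _ hx

/-- `𝔫⁺ + 𝔥 + 𝔫⁻`. -/
def triangularSpan (e f : I → L) (H : Submodule K L) : Submodule K L :=
  monomialSpan K e ⊔ H ⊔ monomialSpan K f

theorem triangularSpan_swap (e f : I → L) (H : Submodule K L) :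
    triangularSpan e f H = triangularSpan f e H := by
  rw [triangularSpan, triangularSpan, sup_assoc, sup_comm, sup_comm H]

variable {e f : I → L} {H : Submodule K L}

theorem lie_mem_monomialSpan_of_eigenvector (he : ∀ h ∈ H, ∀ j, ∃ c : K, ⁅h, e j⁆ = c • e j)
    {h x : L} (hh : h ∈ H) (hx : x ∈ monomialSpan K e) : ⁅h, x⁆ ∈ monomialSpan K e := by
  induction hx using Submodule.span_induction with
  | mem x hx =>
    obtain ⟨⟨i, l⟩, rfl⟩ := hx
    induction l with
    | nil =>
      obtain ⟨c, hc⟩ := he h hh i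
      change ⁅h, e i⁆ ∈ _
      rw [hc]
      exact Submodule.smul_mem _ _ (leftMonomial_mem e i [])
    | cons j l ih =>
      obtain ⟨c, hc⟩ := he h hh j
      change ⁅h, ⁅e j, leftMonomial e i l⁆⁆ ∈ _
      rw [leibniz_lie, hc, smul_lie]
      exact add_mem (Submodule.smul_mem _ _ (leftMonomial_mem e i (j :: l)))
        (lie_mem_monomialSpan e j ih)
  | zero => simp
  | add x y _ _ hx hy => rw [lie_add]; exact add_mem hx hy
  | smul c x _ hx => rw [lie_smul]; exact Submodule.smul_mem _ _ hx

/-- Only the action of `H` by scalars on generators and `[eᵢ, fⱼ] ∈ H` matter; no Serre relations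
and no closure under arbitrary brackets are needed. -/
theorem lie_mem_triangularSpan (he : ∀ h ∈ H, ∀ j, ∃ c : K, ⁅h, e j⁆ = c • e j)
    (hf : ∀ h ∈ H, ∀ j, ∃ c : K, ⁅h, f j⁆ = c • f j) (hef : ∀ i j, ⁅e i, f j⁆ ∈ H)
    (i : I) {x : L} (hx : x ∈ triangularSpan e f H) : ⁅e i, x⁆ ∈ triangularSpan e f H := by
  obtain ⟨y, hy, z, hz, rfl⟩ := Submodule.mem_sup.mp hx
  obtain ⟨y, hy', h, hh, rfl⟩ := Submodule.mem_sup.mp hy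
  clear hx hy
  have h1 : monomialSpan K e ≤ triangularSpan e f H := le_sup_left.trans le_sup_left
  have h2 : H ⊔ monomialSpan K f ≤ triangularSpan e f H := by
    rw [triangularSpan, sup_assoc]; exact le_sup_right
  rw [lie_add, lie_add]
  refine add_mem (add_mem (h1 (lie_mem_monomialSpan e i hy')) (h1 ?_)) (h2 ?_)
  · obtain ⟨c, hc⟩ := he h hh i
    rw [← lie_skew, hc]
    exact neg_mem (Submodule.smul_mem _ _ (leftMonomial_mem e i []))
  -- The target is `H ⊔ monomialSpan K f`, with no `e`-part: the inductive step brackets with `f j`,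
  -- which preserves this smaller space.
  · induction hz using Submodule.span_induction with
    | mem x hx =>
      obtain ⟨⟨k, l⟩, rfl⟩ := hx
      induction l with
      | nil => exact Submodule.mem_sup_left (hef i k)
      | cons j l ih =>
        change ⁅e i, ⁅f j, leftMonomial f k l⁆⁆ ∈ _
        rw [leibniz_lie]
        refine add_mem (Submodule.mem_sup_right
          (lie_mem_monomialSpan_of_eigenvector hf (hef i j) (leftMonomial_mem f k l))) ?_
        obtain ⟨h', hh', w, hw, hhw⟩ := Submodule.mem_sup.mp ih
        rw [← hhw, lie_add]
        refine add_mem (Submodule.mem_sup_right ?_)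
          (Submodule.mem_sup_right (lie_mem_monomialSpan f j hw))
        obtain ⟨c, hc⟩ := hf h' hh' j
        rw [← lie_skew, hc]
        exact neg_mem (Submodule.smul_mem _ _ (leftMonomial_mem f j []))
    | zero => simp
    | add x y _ _ hx hy =>
      rw [lie_add]
      exact add_mem hx hy
    | smul c x _ hx => rw [lie_smul]; exact Submodule.smul_mem _ _ hx

end Triangular

/-- This is `exp(ad e)`, which stops after the quadratic term because `[e, [e, x]] = -2 exe`. The
factor `1/2` is why the Lie-theoretic part is done over `ℚ`. -/
theorem conj_eq_of_sq_zero {A : Type*} [Ring A] [Algebra ℚ A] {e : A} (he : e * e = 0) (x : A) :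
    (1 + e) * x * (1 - e) = x + ⁅e, x⁆ + (1 / 2 : ℚ) • ⁅e, ⁅e, x⁆⁆ := by
  have h1 : ⁅e, ⁅e, x⁆⁆ = (-2 : ℚ) • (e * x * e) := by
    have h : ∀ w, e * (e * w) = 0 := fun w => by rw [← mul_assoc, he, zero_mul]
    simp only [Ring.lie_def, mul_sub, sub_mul, mul_assoc, h, he, mul_zero]
    module
  rw [h1, smul_smul, Ring.lie_def]
  norm_num
  noncomm_ring

/-! ### The rational Lie algebra and its stability under conjugation. -/

namespace MinusculeSet

variable {b : P.Base} (Ψ : MinusculeSet b)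

/-- The diagonal operators `z_v ↦ φ(v) z_v` for linear forms `φ`. -/
def cartan : Submodule ℚ (Module.End ℚ (Ψ.Mod ℚ)) where
  carrier := {x | ∃ φ : Module.Dual ℚ E, ∀ v ∈ Ψ.carrier, x (Ψ.zvec ℚ v) = φ v • Ψ.zvec ℚ v}
  add_mem' := by
    rintro x y ⟨φ, hφ⟩ ⟨ψ, hψ⟩
    exact ⟨φ + ψ, fun v hv => by
      rw [LinearMap.add_apply, hφ v hv, hψ v hv, LinearMap.add_apply, add_smul]⟩
  zero_mem' := ⟨0, by simp⟩
  smul_mem' := by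
    rintro c x ⟨φ, hφ⟩
    exact ⟨c • φ, fun v hv => by
      rw [LinearMap.smul_apply, hφ v hv, LinearMap.smul_apply, smul_smul, smul_eq_mul]⟩

theorem lie_eq_smul_of_mem_cartan {h x : Module.End ℚ (Ψ.Mod ℚ)} (hh : h ∈ Ψ.cartan) {γ : E}
    (hx : x ∈ Ψ.HasWeight ℚ γ) : ∃ c : ℚ, ⁅h, x⁆ = c • x := by
  obtain ⟨φ, hφ⟩ := hh
  refine ⟨φ γ, Ψ.end_ext fun v hv => ?_⟩
  obtain ⟨c, hc⟩ := hx v hv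
  rw [Ring.lie_def, LinearMap.sub_apply, Module.End.mul_apply, Module.End.mul_apply, hφ v hv,
    map_smul, LinearMap.smul_apply, hc, map_smul]
  by_cases hm : v + γ ∈ Ψ.carrier
  · rw [hφ _ hm, map_add]; module
  · simp [zvec_of_notMem _ _ hm]

/-- The Lie algebra spanned by brackets of the `eᵢ`, brackets of the `fᵢ`, and diagonal operators. -/
def lieSpan : Submodule ℚ (Module.End ℚ (Ψ.Mod ℚ)) :=
  triangularSpan (Ψ.eEnd ℚ) (Ψ.fEnd ℚ) Ψ.cartan

theorem e_mem_lieSpan (i : b.support) : Ψ.eEnd ℚ i ∈ Ψ.lieSpan :=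
  Submodule.mem_sup_left (Submodule.mem_sup_left (leftMonomial_mem _ i []))

variable [Finite ι] [P.IsCrystallographic]

theorem coroot'_simple_nonpos {i j : b.support} (hij : i ≠ j) : P.coroot' i (P.root j) ≤ 0 := by
  have h := b.pairingIn_le_zero_of_ne (i := (j : ι)) (j := (i : ι))
    (fun h => hij (Subtype.ext h.symm)) j.2 i.2
  rw [P.root_coroot'_eq_pairing, ← P.algebraMap_pairingIn ℤ, eq_intCast]
  exact_mod_cast h

/-- For `i = j` the bracket is diagonal with eigenvalue `(v, αᵢ^∨)`. For `i ≠ j` it vanishes,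
because distinct simple roots pair non-positively and pairings on `Ψ` stay in `{0, ±1}`. -/
theorem lie_e_f_mem_cartan (i j : b.support) :
    ⁅Ψ.eEnd ℚ i, Ψ.fEnd ℚ j⁆ ∈ Ψ.cartan := by
  rcases eq_or_ne i j with rfl | hij
  · refine ⟨P.coroot' i, fun v hv => ?_⟩
    have h2 := coroot'_root_self (P := P) (i : ι)
    rw [Ring.lie_def, LinearMap.sub_apply, Module.End.mul_apply, Module.End.mul_apply]
    rcases Ψ.coroot'_cases hv i with hi | hi | hi
    · rw [Ψ.e_zvec_of_ne ℚ hv i (by rw [hi]; norm_num),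
        Ψ.f_zvec_of_ne ℚ hv i (by rw [hi]; norm_num), hi]
      simp
    · have hm := Ψ.sub_mem hv i hi
      rw [Ψ.e_zvec_of_ne ℚ hv i (by rw [hi]; norm_num), Ψ.f_zvec ℚ hv i hi,
        Ψ.e_zvec ℚ hm i (by rw [map_sub, hi, h2]; norm_num), hi]
      simp
    · have hm := Ψ.add_mem hv i hi
      rw [Ψ.f_zvec_of_ne ℚ hv i (by rw [hi]; norm_num), Ψ.e_zvec ℚ hv i hi,
        Ψ.f_zvec ℚ hm i (by rw [map_add, hi, h2]; norm_num), hi]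
      simp
  · refine ⟨0, fun v hv => ?_⟩
    have hle := coroot'_simple_nonpos hij
    have hle' := coroot'_simple_nonpos hij.symm
    have hz := P.pairing_eq_zero_iff' (i := (i : ι)) (j := (j : ι))
    rw [← P.root_coroot'_eq_pairing, ← P.root_coroot'_eq_pairing] at hz
    have hvi := Ψ.coroot'_cases hv i
    have hvj := Ψ.coroot'_cases hv j
    rw [Ring.lie_def, LinearMap.sub_apply, Module.End.mul_apply, Module.End.mul_apply,
      LinearMap.zero_apply, zero_smul, sub_eq_zero]
    generalize ha : P.coroot' i (P.root j) = a at *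
    generalize hb : P.coroot' j (P.root i) = c at *
    by_cases hj : P.coroot' j v = 1 <;> by_cases hi : P.coroot' i v = -1
    · rw [Ψ.f_zvec ℚ hv j hj, Ψ.e_zvec ℚ hv i hi]
      have hmj := Ψ.sub_mem hv j hj
      have hmi := Ψ.add_mem hv i hi
      by_cases h0 : a = 0
      · have h0' := hz.mpr h0
        rw [Ψ.e_zvec ℚ hmj i (by rw [map_sub, hi, ha, h0]; norm_num),
          Ψ.f_zvec ℚ hmi j (by rw [map_add, hj, hb, h0']; norm_num)]
        congr 1
        abel
      · rw [Ψ.e_zvec_of_ne ℚ hmj i (by rw [map_sub, hi, ha]; simpa using h0),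
          Ψ.f_zvec_of_ne ℚ hmi j (by rw [map_add, hj, hb]; simpa [hz] using h0)]
    · rw [Ψ.f_zvec ℚ hv j hj, Ψ.e_zvec_of_ne ℚ hv i hi, map_zero,
        Ψ.e_zvec_of_ne ℚ (Ψ.sub_mem hv j hj) i]
      rw [map_sub, ha]
      intro h
      rcases hvi with h' | h' | h' <;> first | exact hi h' | linarith
    · rw [Ψ.f_zvec_of_ne ℚ hv j hj, Ψ.e_zvec ℚ hv i hi, map_zero,
        Ψ.f_zvec_of_ne ℚ (Ψ.add_mem hv i hi) j]
      rw [map_add, hb]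
      intro h
      rcases hvj with h' | h' | h' <;> first | exact hj h' | linarith
    · rw [Ψ.f_zvec_of_ne ℚ hv j hj, Ψ.e_zvec_of_ne ℚ hv i hi, map_zero, map_zero]

theorem lie_e_mem_lieSpan (i : b.support) {x : Module.End ℚ (Ψ.Mod ℚ)} (hx : x ∈ Ψ.lieSpan) :
    ⁅Ψ.eEnd ℚ i, x⁆ ∈ Ψ.lieSpan :=
  lie_mem_triangularSpan (fun _ hh j => Ψ.lie_eq_smul_of_mem_cartan hh (Ψ.e_hasWeight j))
    (fun _ hh j => Ψ.lie_eq_smul_of_mem_cartan hh (Ψ.f_hasWeight j)) Ψ.lie_e_f_mem_cartan i hx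

theorem lie_f_mem_lieSpan (i : b.support) {x : Module.End ℚ (Ψ.Mod ℚ)} (hx : x ∈ Ψ.lieSpan) :
    ⁅Ψ.fEnd ℚ i, x⁆ ∈ Ψ.lieSpan := by
  rw [lieSpan, triangularSpan_swap] at hx ⊢
  refine lie_mem_triangularSpan
    (fun _ hh j => Ψ.lie_eq_smul_of_mem_cartan hh (Ψ.f_hasWeight j))
    (fun _ hh j => Ψ.lie_eq_smul_of_mem_cartan hh (Ψ.e_hasWeight j)) (fun i j => ?_) i hx
  rw [← lie_skew]
  exact neg_mem (Ψ.lie_e_f_mem_cartan j i)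

omit [Finite ι] [P.IsCrystallographic] in
theorem conj_mem_lieSpan {e : Module.End ℚ (Ψ.Mod ℚ)} (he : e * e = 0)
    (hl : ∀ x ∈ Ψ.lieSpan, ⁅e, x⁆ ∈ Ψ.lieSpan) {x : Module.End ℚ (Ψ.Mod ℚ)}
    (hx : x ∈ Ψ.lieSpan) : (1 + e) * x * (1 - e) ∈ Ψ.lieSpan := by
  rw [conj_eq_of_sq_zero he]
  exact AddMemClass.add_mem (AddMemClass.add_mem hx (hl _ hx)) (Submodule.smul_mem _ _ (hl _ (hl _ hx)))

omit [Finite ι] [P.IsCrystallographic] in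
theorem conj_mem_lieSpan' {e : Module.End ℚ (Ψ.Mod ℚ)} (he : e * e = 0)
    (hl : ∀ x ∈ Ψ.lieSpan, ⁅e, x⁆ ∈ Ψ.lieSpan) {x : Module.End ℚ (Ψ.Mod ℚ)}
    (hx : x ∈ Ψ.lieSpan) : (1 - e) * x * (1 + e) ∈ Ψ.lieSpan := by
  have := Ψ.conj_mem_lieSpan (e := -e) (by simpa using he)
    (fun x hx => by rw [neg_lie]; exact neg_mem (hl x hx)) hx
  simpa [sub_eq_add_neg] using this

theorem conj_n_mem_lieSpan (i : b.support) {x : Module.End ℚ (Ψ.Mod ℚ)} (hx : x ∈ Ψ.lieSpan) :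
    (Ψ.nUnit ℚ i).val * x * (Ψ.nUnit ℚ i)⁻¹.val ∈ Ψ.lieSpan := by
  have h1 := Ψ.conj_mem_lieSpan (Ψ.eEnd_mul_self ℚ i) (fun _ => Ψ.lie_e_mem_lieSpan i) hx
  have h2 := Ψ.conj_mem_lieSpan' (Ψ.fEnd_mul_self ℚ i) (fun _ => Ψ.lie_f_mem_lieSpan i) h1
  have h3 := Ψ.conj_mem_lieSpan (Ψ.eEnd_mul_self ℚ i) (fun _ => Ψ.lie_e_mem_lieSpan i) h2
  rw [n_val, n_inv_val]
  simpa only [mul_assoc] using h3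

theorem conj_n_inv_mem_lieSpan (i : b.support) {x : Module.End ℚ (Ψ.Mod ℚ)}
    (hx : x ∈ Ψ.lieSpan) : (Ψ.nUnit ℚ i)⁻¹.val * x * (Ψ.nUnit ℚ i).val ∈ Ψ.lieSpan := by
  have h1 := Ψ.conj_mem_lieSpan' (Ψ.eEnd_mul_self ℚ i) (fun _ => Ψ.lie_e_mem_lieSpan i) hx
  have h2 := Ψ.conj_mem_lieSpan (Ψ.fEnd_mul_self ℚ i) (fun _ => Ψ.lie_f_mem_lieSpan i) h1
  have h3 := Ψ.conj_mem_lieSpan' (Ψ.eEnd_mul_self ℚ i) (fun _ => Ψ.lie_e_mem_lieSpan i) h2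
  rw [n_val, n_inv_val]
  simpa only [mul_assoc] using h3

/-- Conjugation by a product of `nᵢ` along a word, and by its inverse. -/
theorem conj_prod_mem_lieSpan (l : List b.support) {x : Module.End ℚ (Ψ.Mod ℚ)} {γ : E} :
    (x ∈ Ψ.lieSpan → (l.map (Ψ.nUnit ℚ)).prod.val * x * (l.map (Ψ.nUnit ℚ)).prod⁻¹.val ∈
      Ψ.lieSpan) ∧
    (x ∈ Ψ.lieSpan → (l.map (Ψ.nUnit ℚ)).prod⁻¹.val * x * (l.map (Ψ.nUnit ℚ)).prod.val ∈
      Ψ.lieSpan) ∧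
    (x ∈ Ψ.HasWeight ℚ ((l.map fun j : b.support => P.reflection (j : ι)).prod γ) →
      (l.map (Ψ.nUnit ℚ)).prod⁻¹.val * x * (l.map (Ψ.nUnit ℚ)).prod.val ∈ Ψ.HasWeight ℚ γ) := by
  induction l generalizing x with
  | nil => simp
  | cons j l ih =>
    simp only [List.map_cons, List.prod_cons, mul_inv_rev, Units.val_mul]
    refine ⟨fun hx => ?_, fun hx => ?_, fun hx => ?_⟩
    · simpa only [mul_assoc] using Ψ.conj_n_mem_lieSpan j (ih.1 hx)
    · simpa only [mul_assoc] using ih.2.1 (Ψ.conj_n_inv_mem_lieSpan j hx)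
    · have := HasWeight.conj_n_inv Ψ hx j
      rw [LinearEquiv.mul_apply, P.reflection_same] at this
      simpa only [mul_assoc] using ih.2.2 this

theorem rootEnd_mem_lieSpan (W : RootWords b) (a : ι) : Ψ.rootEnd ℚ W a ∈ Ψ.lieSpan := by
  rw [rootEnd_eq]
  -- `γ` occurs only in the weight clause of `conj_prod_mem_lieSpan`; here it is a dummy.
  exact (Ψ.conj_prod_mem_lieSpan (γ := 0) _).1 (Ψ.e_mem_lieSpan _)

/-- `𝐞_α` normalises the Lie algebra. -/
theorem lie_rootEnd_mem_lieSpan (W : RootWords b) (a : ι) {x : Module.End ℚ (Ψ.Mod ℚ)}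
    (hx : x ∈ Ψ.lieSpan) : ⁅Ψ.rootEnd ℚ W a, x⁆ ∈ Ψ.lieSpan := by
  have h1 := (Ψ.conj_prod_mem_lieSpan (γ := 0) (W.word a)).2.1 hx
  have h2 := (Ψ.conj_prod_mem_lieSpan (γ := 0) (W.word a)).1
    (Ψ.lie_e_mem_lieSpan (W.simple a) h1)
  rw [rootEnd_eq]
  convert h2 using 1
  simp only [Ring.lie_def, mul_sub, sub_mul, mul_assoc, Units.mul_inv_cancel_left, Units.mul_inv,
    mul_one]

end MinusculeSet

/-! ### Sums of simple roots: height, coefficients, positivity. -/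

section ListWeight

variable (b : P.Base)

/-- The sum of a list of simple roots. -/
def listWeight (l : List b.support) : E := (l.map fun j : b.support => P.root j).sum

variable {b}

theorem listWeight_cons (i : b.support) (l : List b.support) :
    listWeight b (i :: l) = P.root i + listWeight b l := by simp [listWeight]

theorem listWeight_append (l l' : List b.support) :
    listWeight b (l ++ l') = listWeight b l + listWeight b l' := by simp [listWeight]

theorem listWeight_replicate (k : ℕ) (i : b.support) :
    listWeight b (List.replicate k i) = k • P.root i := by simp [listWeight]

variable [P.IsRootSystem]

variable (b) in
/-- The height, as a linear form. -/
def heightForm : Module.Dual ℚ E := b.toWeightBasis.constr ℚ fun _ => (1 : ℚ)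

theorem heightForm_root (i : b.support) : heightForm b (P.root i) = 1 := by
  rw [heightForm, ← b.toWeightBasis_apply, Module.Basis.constr_basis]

theorem heightForm_listWeight (l : List b.support) : heightForm b (listWeight b l) = l.length := by
  induction l with
  | nil => simp [listWeight]
  | cons i l ih => rw [listWeight_cons, map_add, heightForm_root, ih]; simp; ring

theorem coord_listWeight [BEq b.support] [LawfulBEq b.support] (j : b.support)
    (l : List b.support) : b.toWeightBasis.coord j (listWeight b l) = l.count j := by
  classical
  induction l with
  | nil => simp [listWeight]
  | cons i l ih =>
    rw [listWeight_cons, map_add, ih, Module.Basis.coord_apply, b.toWeightBasis_repr_root,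
      Finsupp.single_apply, List.count_cons]
    by_cases h : i = j <;> simp [h, add_comm]

theorem coord_root [DecidableEq b.support] (j i : b.support) :
    b.toWeightBasis.coord j (P.root i) = if i = j then 1 else 0 := by
  rw [Module.Basis.coord_apply, b.toWeightBasis_repr_root, Finsupp.single_apply]

theorem listWeight_ne_zero {l : List b.support} (hl : l ≠ []) : listWeight b l ≠ 0 := fun h => by
  have := heightForm_listWeight l
  rw [h, map_zero, eq_comm, Nat.cast_eq_zero, List.length_eq_zero_iff] at this
  exact hl this

theorem listWeight_ne_neg {l l' : List b.support} (hl : l ≠ []) :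
    listWeight b l ≠ -listWeight b l' := by
  intro h
  have := congrArg (heightForm b) h
  rw [map_neg, heightForm_listWeight, heightForm_listWeight] at this
  have h1 : 0 < (l.length : ℚ) := by exact_mod_cast List.length_pos_iff.mpr hl
  have h2 : 0 ≤ (l'.length : ℚ) := by positivity
  linarith

/-- Otherwise `B(γ, αᵢ) ≤ 0` for all `i`, where `B` is the root form. As `γ` is a sum of simple
roots, `B(γ, γ) ≤ 0`; but `B(γ, γ)` is a sum of squares of coroot values, so `γ = 0`. -/
theorem exists_coroot'_pos [Finite ι] {l : List b.support} (hl : l ≠ []) :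
    ∃ i : b.support, 0 < P.coroot' i (listWeight b l) := by
  classical
  have : Fintype ι := Fintype.ofFinite ι
  by_contra! hneg
  set γ := listWeight b l with hγ
  have hB : ∀ i : b.support, P.RootForm γ (P.root i) ≤ 0 := by
    intro i
    -- Invariance of `B` under `sᵢ` yields `2B(γ, αᵢ) = (γ, αᵢ^∨) B(αᵢ, αᵢ)`.
    have h1 := P.rootForm_reflection_reflection_apply i γ (P.root i)
    rw [P.reflection_apply_self, P.reflection_apply, map_neg, map_sub, map_smul,
      LinearMap.sub_apply, LinearMap.smul_apply, smul_eq_mul] at h1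
    have h2 : 0 ≤ P.RootForm (P.root i) (P.root i) := by
      rw [P.rootForm_apply_apply]
      exact Finset.sum_nonneg fun _ _ => mul_self_nonneg _
    nlinarith [hneg i, mul_nonneg (neg_nonneg.mpr (hneg i)) h2]
  have hle : ∀ m : List b.support, P.RootForm γ (listWeight b m) ≤ 0 := by
    intro m
    induction m with
    | nil => simp [listWeight]
    | cons i m ih => rw [listWeight_cons, map_add]; linarith [hB i]
  have h0 := hle l
  rw [← hγ, P.rootForm_apply_apply] at h0
  refine listWeight_ne_zero hl ?_
  rw [P.eq_zero_iff_forall_coroot'_eq_zero]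
  intro i
  have hs := (Finset.sum_eq_zero_iff_of_nonneg
    (f := fun i => P.coroot' i γ * P.coroot' i γ) (fun _ _ => mul_self_nonneg _)).mp
    (le_antisymm h0 (Finset.sum_nonneg fun _ _ => mul_self_nonneg _)) i (Finset.mem_univ i)
  exact mul_self_eq_zero.mp hs

omit [P.IsRootSystem] in
theorem exists_root_eq_listWeight [Finite ι] [P.IsCrystallographic] {a : ι} (ha : b.IsPos a) :
    ∃ l : List b.support, l ≠ [] ∧ P.root a = listWeight b l := by
  refine ha.induction_on_add (p := fun a => ∃ l : List b.support, l ≠ [] ∧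
    P.root a = listWeight b l) (fun i hi => ⟨[⟨i, hi⟩], by simp, by simp [listWeight]⟩) ?_
  rintro i j k hk ⟨l, -, hl⟩ hj
  exact ⟨⟨j, hj⟩ :: l, by simp, by rw [listWeight_cons, hk, hl, add_comm]⟩

end ListWeight

/-! ### Weight spaces of the Lie algebra. -/

namespace MinusculeSet

variable {b : P.Base} (Ψ : MinusculeSet b)

theorem leftMonomial_e_hasWeight (i : b.support) (l : List b.support) :
    leftMonomial (Ψ.eEnd ℚ) i l ∈ Ψ.HasWeight ℚ (listWeight b (i :: l)) := by
  induction l with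
  | nil => simpa [listWeight] using! Ψ.e_hasWeight (R := ℚ) i
  | cons j l ih =>
    have h := HasWeight.lie Ψ (Ψ.e_hasWeight j) ih
    rw [listWeight_cons] at h ⊢
    rw [listWeight_cons, add_left_comm]
    exact h

theorem leftMonomial_f_hasWeight (i : b.support) (l : List b.support) :
    leftMonomial (Ψ.fEnd ℚ) i l ∈ Ψ.HasWeight ℚ (-listWeight b (i :: l)) := by
  induction l with
  | nil => simpa [listWeight] using! Ψ.f_hasWeight (R := ℚ) i
  | cons j l ih =>
    have h := HasWeight.lie Ψ (Ψ.f_hasWeight j) ih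
    rw [listWeight_cons] at h ⊢
    rw [listWeight_cons, add_left_comm, neg_add]
    exact h

theorem cartan_hasWeight {h : Module.End ℚ (Ψ.Mod ℚ)} (hh : h ∈ Ψ.cartan) :
    h ∈ Ψ.HasWeight ℚ 0 := by
  obtain ⟨φ, hφ⟩ := hh
  exact fun v hv => ⟨φ v, by rw [hφ v hv, add_zero]⟩

/-- An element of weight `γ` of a span of weight vectors is in the span of those of weight `γ`. -/
theorem mem_span_weight {R : Type*} [CommRing R]
    {S : Set (Module.End R (Ψ.Mod R) × E)} (hS : ∀ p ∈ S, p.1 ∈ Ψ.HasWeight R p.2)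
    {x : Module.End R (Ψ.Mod R)} (hx : x ∈ Submodule.span R (Prod.fst '' S)) {γ : E}
    (hγ : x ∈ Ψ.HasWeight R γ) : x ∈ Submodule.span R {s | (s, γ) ∈ S} := by
  -- Here `y` is the weight-`γ` component of `x`, compared with `x` only through the coefficients of
  -- `z_{v+γ}` in the images of `z_v`. The weight of `x` itself is left aside, since the induction
  -- passes through arbitrary elements of the span.
  have key : ∃ y ∈ Submodule.span R {s | (s, γ) ∈ S}, ∀ v ∈ Ψ.carrier, ∀ w : Ψ.carrier,
      (w : E) = v + γ → Ψ.coord R w (x (Ψ.zvec R v)) = Ψ.coord R w (y (Ψ.zvec R v)) := by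
    clear hγ
    induction hx using Submodule.span_induction with
    | mem x hx =>
      obtain ⟨⟨s, δ⟩, hs, rfl⟩ := hx
      by_cases hδ : δ = γ
      · subst hδ
        exact ⟨s, Submodule.subset_span hs, fun _ _ _ _ => rfl⟩
      · refine ⟨0, zero_mem _, fun v hv w hw => ?_⟩
        obtain ⟨c, hc⟩ := hS _ hs v hv
        change Ψ.coord R w (s (Ψ.zvec R v)) = _
        change s (Ψ.zvec R v) = _ at hc
        rw [hc, map_smul, coord_zvec_of_ne, smul_zero, LinearMap.zero_apply, map_zero]
        rw [hw]
        exact fun h => hδ (add_left_cancel h)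
    | zero => exact ⟨0, zero_mem _, fun _ _ _ _ => rfl⟩
    | add x x' _ _ ih ih' =>
      obtain ⟨y, hy, h⟩ := ih
      obtain ⟨y', hy', h'⟩ := ih'
      exact ⟨y + y', AddMemClass.add_mem hy hy', fun v hv w hw => by
        rw [LinearMap.add_apply, LinearMap.add_apply, map_add, map_add, h v hv w hw,
          h' v hv w hw]⟩
    | smul c x _ ih =>
      obtain ⟨y, hy, h⟩ := ih
      exact ⟨c • y, Submodule.smul_mem _ _ hy, fun v hv w hw => by
        rw [LinearMap.smul_apply, LinearMap.smul_apply, map_smul, map_smul, h v hv w hw]⟩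
  obtain ⟨y, hy, h⟩ := key
  have hyγ : y ∈ Ψ.HasWeight R γ :=
    (Submodule.span_le (p := Ψ.HasWeight R γ)).mpr (fun s hs => hS (s, γ) hs) hy
  suffices x = y by rwa [this]
  refine Ψ.end_ext fun v hv => ?_
  obtain ⟨c, hc⟩ := hγ v hv
  obtain ⟨d, hd⟩ := hyγ v hv
  by_cases hm : v + γ ∈ Ψ.carrier
  · have := h v hv ⟨_, hm⟩ rfl
    rw [hc, hd, map_smul, map_smul] at this
    have h1 := Ψ.coord_zvec_self R ⟨_, hm⟩
    change Ψ.coord R ⟨_, hm⟩ (Ψ.zvec R (v + γ)) = 1 at h1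
    rw [h1, smul_eq_mul, smul_eq_mul, mul_one, mul_one] at this
    rw [hc, hd, this]
  · rw [hc, hd, zvec_of_notMem _ _ hm, smul_zero, smul_zero]

/-- The generators of `lieSpan`, with their weights. -/
def lieGen : Set (Module.End ℚ (Ψ.Mod ℚ) × E) :=
  (Set.range fun p : b.support × List b.support =>
    (leftMonomial (Ψ.eEnd ℚ) p.1 p.2, listWeight b (p.1 :: p.2))) ∪
  ((fun h => (h, (0 : E))) '' (Ψ.cartan : Set (Module.End ℚ (Ψ.Mod ℚ)))) ∪
  (Set.range fun p : b.support × List b.support =>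
    (leftMonomial (Ψ.fEnd ℚ) p.1 p.2, -listWeight b (p.1 :: p.2)))

theorem lieSpan_le_span : Ψ.lieSpan ≤ Submodule.span ℚ (Prod.fst '' Ψ.lieGen) := by
  refine sup_le (sup_le ?_ ?_) ?_
  · refine Submodule.span_mono ?_
    rintro _ ⟨p, rfl⟩
    exact ⟨_, Or.inl (Or.inl ⟨p, rfl⟩), rfl⟩
  · exact fun h hh => Submodule.subset_span ⟨_, Or.inl (Or.inr ⟨h, hh, rfl⟩), rfl⟩
  · refine Submodule.span_mono ?_
    rintro _ ⟨p, rfl⟩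
    exact ⟨_, Or.inr ⟨p, rfl⟩, rfl⟩

theorem mem_span_lieGen {x : Module.End ℚ (Ψ.Mod ℚ)} (hx : x ∈ Ψ.lieSpan) {γ : E}
    (hγ : x ∈ Ψ.HasWeight ℚ γ) : x ∈ Submodule.span ℚ {s | (s, γ) ∈ Ψ.lieGen} := by
  refine Ψ.mem_span_weight ?_ (Ψ.lieSpan_le_span hx) hγ
  rintro _ ((⟨p, rfl⟩ | ⟨h, hh, rfl⟩) | ⟨p, rfl⟩)
  · exact Ψ.leftMonomial_e_hasWeight _ _
  · exact Ψ.cartan_hasWeight hh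
  · exact Ψ.leftMonomial_f_hasWeight _ _

variable [P.IsRootSystem]

theorem mem_span_leftMonomial {x : Module.End ℚ (Ψ.Mod ℚ)} (hx : x ∈ Ψ.lieSpan)
    {l : List b.support} (hl : l ≠ []) (hγ : x ∈ Ψ.HasWeight ℚ (listWeight b l)) :
    x ∈ Submodule.span ℚ {s | ∃ i m, listWeight b (i :: m) = listWeight b l ∧
      leftMonomial (Ψ.eEnd ℚ) i m = s} := by
  refine Submodule.span_mono ?_ (Ψ.mem_span_lieGen hx hγ)
  rintro s ((⟨⟨i, m⟩, h⟩ | ⟨h, hh, h'⟩) | ⟨⟨i, m⟩, h⟩)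
  · exact ⟨i, m, congrArg Prod.snd h, congrArg Prod.fst h⟩
  · exact absurd (congrArg Prod.snd h').symm (listWeight_ne_zero hl)
  · exact absurd (congrArg Prod.snd h).symm (listWeight_ne_neg hl)

/-- A bracket monomial of weight `αᵢ` has height one, so it is `eᵢ` itself. -/
theorem eq_smul_e_of_hasWeight {x : Module.End ℚ (Ψ.Mod ℚ)} (hx : x ∈ Ψ.lieSpan)
    {i : b.support} (hi : x ∈ Ψ.HasWeight ℚ (P.root i)) : ∃ c : ℚ, x = c • Ψ.eEnd ℚ i := by
  have h1 : listWeight b [i] = P.root i := by simp [listWeight]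
  have h := Ψ.mem_span_leftMonomial hx (l := [i]) (by simp) (by rwa [h1])
  have h2 : {s | ∃ j m, listWeight b (j :: m) = listWeight b [i] ∧
      leftMonomial (Ψ.eEnd ℚ) j m = s} ⊆ {Ψ.eEnd ℚ i} := by
    rintro _ ⟨j, m, hjm, rfl⟩
    have hlen := congrArg (heightForm b) hjm
    rw [heightForm_listWeight, heightForm_listWeight] at hlen
    have hm : m = [] := by
      rw [← List.length_eq_zero_iff]
      have : m.length + 1 = 1 := by exact_mod_cast hlen
      omega
    subst hm
    have : j = i := by
      rw [h1] at hjm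
      exact Subtype.ext (P.root.injective (by simpa [listWeight] using hjm))
    subst this
    rfl
  obtain ⟨c, hc⟩ := Submodule.mem_span_singleton.mp (Submodule.span_mono h2 h)
  exact ⟨c, hc.symm⟩

omit [P.IsRootSystem] in
theorem leftMonomial_replicate (i : b.support) (k : ℕ) :
    leftMonomial (Ψ.eEnd ℚ) i (List.replicate (k + 1) i) = 0 := by
  induction k with
  | zero => exact lie_self (Ψ.eEnd ℚ i)
  | succ k ih =>
    change ⁅Ψ.eEnd ℚ i, leftMonomial (Ψ.eEnd ℚ) i (List.replicate (k + 1) i)⁆ = 0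
    rw [ih, lie_zero]

/-- A monomial of weight `(k + 2)αᵢ` involves only `eᵢ`, and its innermost bracket is `[eᵢ, eᵢ] =
0`. -/
theorem eq_zero_of_hasWeight_replicate {x : Module.End ℚ (Ψ.Mod ℚ)} (hx : x ∈ Ψ.lieSpan)
    {i : b.support} {k : ℕ}
    (hi : x ∈ Ψ.HasWeight ℚ (listWeight b (List.replicate (k + 2) i))) : x = 0 := by
  classical
  have h := Ψ.mem_span_leftMonomial hx (by simp [List.replicate_succ]) hi
  have h2 : {s | ∃ j m, listWeight b (j :: m) = listWeight b (List.replicate (k + 2) i) ∧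
      leftMonomial (Ψ.eEnd ℚ) j m = s} ⊆ {0} := by
    rintro _ ⟨j, m, hjm, rfl⟩
    have hperm : List.Perm (j :: m) (List.replicate (k + 2) i) := by
      rw [List.perm_iff_count]
      intro a
      have := congrArg (b.toWeightBasis.coord a) hjm
      rw [coord_listWeight, coord_listWeight] at this
      exact_mod_cast this
    have heq := List.perm_replicate.mp hperm
    rw [List.replicate_succ, List.cons.injEq] at heq
    obtain ⟨rfl, rfl⟩ := heq
    exact Ψ.leftMonomial_replicate j k
  have := Submodule.span_mono h2 h
  simpa using this

variable [Finite ι] [P.IsCrystallographic]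

/-- Induction on height. If `γ` pairs positively with `αᵢ^∨`, conjugating by `nᵢ` gives a nonzero
element of weight `sᵢγ`, of smaller height, and roots are stable under `sᵢ`. The descent can only
leave the positive side from a multiple of `αᵢ`. -/
theorem listWeight_mem_range_of_ne_zero {x : Module.End ℚ (Ψ.Mod ℚ)} (hx : x ∈ Ψ.lieSpan)
    (hx0 : x ≠ 0) {l : List b.support} (hl : l ≠ []) (hγ : x ∈ Ψ.HasWeight ℚ (listWeight b l)) :
    listWeight b l ∈ Set.range P.root := by
  classical
  induction hn : l.length using Nat.strong_induction_on generalizing x l with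
  | _ n ih =>
  obtain ⟨i, hi⟩ := exists_coroot'_pos hl
  set y := (Ψ.nUnit ℚ i)⁻¹.val * x * (Ψ.nUnit ℚ i).val with hy
  have hyl : y ∈ Ψ.lieSpan := Ψ.conj_n_inv_mem_lieSpan i hx
  have hyw := HasWeight.conj_n_inv Ψ hγ i
  rw [← hy] at hyw
  have hy0 : y ≠ 0 := fun h => hx0 (by
    have : x = (Ψ.nUnit ℚ i).val * y * (Ψ.nUnit ℚ i)⁻¹.val := by simp [hy, mul_assoc]
    rw [this, h, mul_zero, zero_mul])
  have hne : ({s | (s, P.reflection i (listWeight b l)) ∈ Ψ.lieGen}).Nonempty := by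
    by_contra hempty
    rw [Set.not_nonempty_iff_eq_empty] at hempty
    have := Ψ.mem_span_lieGen hyl hyw
    rw [hempty, Submodule.span_empty] at this
    exact hy0 (by simpa using this)
  obtain ⟨s, ((⟨⟨j, m⟩, h⟩ | ⟨h', hh, h⟩) | ⟨⟨j, m⟩, h⟩)⟩ := hne
  · have hw : listWeight b (j :: m) = P.reflection i (listWeight b l) := congrArg Prod.snd h
    have hlen := congrArg (heightForm b) hw
    rw [P.reflection_apply, map_sub, map_smul, heightForm_listWeight, heightForm_listWeight,
      heightForm_root, smul_eq_mul, mul_one] at hlen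
    have hlt : (j :: m).length < n := by
      rw [← hn]
      have : ((j :: m).length : ℚ) < l.length := by linarith
      exact_mod_cast this
    obtain ⟨a, ha⟩ := ih _ hlt hyl hy0 (by simp) (hw ▸ hyw) rfl
    exact ⟨P.reflectionPerm i a, by rw [P.root_reflectionPerm, ha, hw, P.reflection_same]⟩
  · have hw : 0 = P.reflection i (listWeight b l) := congrArg Prod.snd h
    exact absurd ((P.reflection i).map_eq_zero_iff.mp hw.symm) (listWeight_ne_zero hl)
  · have hw : -listWeight b (j :: m) = P.reflection i (listWeight b l) := congrArg Prod.snd h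
    -- `sᵢ` changes only the coefficient of `αᵢ`; any other coefficient is both non-negative and
    -- non-positive.
    have hcount : ∀ a ≠ i, l.count a = 0 := by
      intro a ha
      have := congrArg (b.toWeightBasis.coord a) hw
      rw [P.reflection_apply, map_sub, map_smul, coord_root, if_neg ha.symm, smul_zero, sub_zero,
        map_neg, coord_listWeight, coord_listWeight] at this
      have h1 : (0 : ℚ) ≤ ((j :: m).count a : ℕ) := by positivity
      have h2 : (0 : ℚ) ≤ (l.count a : ℕ) := by positivity
      have : ((l.count a : ℕ) : ℚ) = 0 := by linarith
      exact_mod_cast this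
    have hrep : l = List.replicate l.length i := by
      rw [List.eq_replicate_iff]
      refine ⟨rfl, fun a ha => ?_⟩
      by_contra hai
      exact List.count_eq_zero.mp (hcount a hai) ha
    rcases hk : l.length with _ | _ | k
    · exact absurd (List.length_eq_zero_iff.mp hk) hl
    · rw [hrep, hk, listWeight_replicate, zero_add, one_smul]
      exact ⟨i, rfl⟩
    · rw [hk] at hrep
      rw [hrep] at hγ
      exact absurd (Ψ.eq_zero_of_hasWeight_replicate hx hγ) hx0

theorem eq_smul_rootEnd_of_hasWeight (W : RootWords b) {x : Module.End ℚ (Ψ.Mod ℚ)}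
    (hx : x ∈ Ψ.lieSpan) {a : ι} (ha : x ∈ Ψ.HasWeight ℚ (P.root a)) :
    ∃ c : ℚ, x = c • Ψ.rootEnd ℚ W a := by
  rw [W.root_eq] at ha
  have h1 := (Ψ.conj_prod_mem_lieSpan (γ := 0) (W.word a)).2.1 hx
  have h2 := (Ψ.conj_prod_mem_lieSpan (W.word a)).2.2 ha
  obtain ⟨c, hc⟩ := Ψ.eq_smul_e_of_hasWeight h1 h2
  refine ⟨c, ?_⟩
  rw [rootEnd_eq]
  rw [← smul_mul_assoc, ← mul_smul_comm, ← hc]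
  simp [mul_assoc]

omit [Finite ι] [P.IsCrystallographic] [P.IsRootSystem] in
-- `Ψ` spans a nonzero Weyl-stable subspace, which is everything by irreducibility, so some `v ∈ Ψ`
-- pairs nontrivially with `a^∨`; reflecting in `a` corrects the sign.
theorem exists_coroot'_eq_neg_one [P.IsIrreducible] (a : ι) :
    ∃ v ∈ Ψ.carrier, P.coroot' a v = -1 := by
  have hne : ∃ v ∈ Ψ.carrier, v ≠ 0 := by
    obtain ⟨S, ⟨v, hv⟩, hmin, hS⟩ := Ψ.isUnion
    refine ⟨v, ?_, (hmin v hv).ne_zero⟩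
    rw [hS]
    exact Set.mem_biUnion hv (MulAction.mem_orbit_self v)
  obtain ⟨v₀, hv₀, hv₀'⟩ := hne
  have htop : Submodule.span ℚ Ψ.carrier = ⊤ := by
    refine RootPairing.IsIrreducible.eq_top_of_invtSubmodule_reflection (P := P) _ (fun i => ?_) ?_
    · rw [Module.End.mem_invtSubmodule, Submodule.span_le]
      exact fun v hv => Submodule.subset_span (Ψ.reflection_mem_of_root hv i)
    · exact fun h => hv₀' (by
        have := Submodule.subset_span (R := ℚ) hv₀
        rw [h] at this
        simpa using this)
  have hex : ∃ v ∈ Ψ.carrier, P.coroot' a v ≠ 0 := by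
    by_contra! h0
    have hle : Submodule.span ℚ Ψ.carrier ≤ LinearMap.ker (P.coroot' a) :=
      Submodule.span_le.mpr h0
    rw [htop] at hle
    have h2 := coroot'_root_self (P := P) a
    rw [LinearMap.mem_ker.mp (hle (Submodule.mem_top (x := P.root a)))] at h2
    norm_num at h2
  obtain ⟨v, hv, hva⟩ := hex
  rcases Ψ.coroot'_cases hv a with h | h | h
  · exact absurd h hva
  · refine ⟨_, Ψ.reflection_mem_of_root hv a, ?_⟩
    rw [reflection_of_one h, map_sub, h, coroot'_root_self]
    norm_num
  · exact ⟨v, hv, h⟩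

end MinusculeSet

namespace MinusculeSet

variable {b : P.Base} (Ψ : MinusculeSet b)

/-! ### Base change from `ℤ` to an arbitrary ring. -/

section BaseChange

variable (R : Type*) [CommRing R]

/-- The endomorphisms of `M_R`. -/
abbrev EndMod : Type _ := Module.End R (Ψ.Mod R)

/-- The canonical map `M_ℤ → M_R`. -/
def castMod : Ψ.Mod ℤ →+ Ψ.Mod R := Finsupp.mapRange.addMonoidHom (Int.castAddHom R)

theorem castMod_zvec (v : E) : Ψ.castMod R (Ψ.zvec ℤ v) = Ψ.zvec R v := by
  by_cases h : v ∈ Ψ.carrier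
  · rw [zvec_of_mem _ _ h, zvec_of_mem _ _ h]
    refine (Finsupp.mapRange_single (f := (Int.cast : ℤ → R)) (hf := Int.cast_zero)).trans ?_
    rw [Int.cast_one]
  · rw [zvec_of_notMem _ _ h, zvec_of_notMem _ _ h, map_zero]

theorem castMod_injective [CharZero R] : Function.Injective (Ψ.castMod R) :=
  Finsupp.mapRange_injective _ Int.cast_zero Int.cast_injective

theorem addHom_ext {A : Type*} [AddCommGroup A] {f g : Ψ.Mod ℤ →+ A}
    (h : ∀ v ∈ Ψ.carrier, f (Ψ.zvec ℤ v) = g (Ψ.zvec ℤ v)) : f = g := by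
  refine Finsupp.addHom_ext' fun μ => AddMonoidHom.ext_int ?_
  have := h μ μ.2
  rwa [zvec_of_mem _ _ μ.2] at this

variable {R}

/-- `y` is obtained from `x` by base change from `ℤ` to `R`. -/
def IsBaseChange (x : Ψ.EndMod ℤ) (y : Ψ.EndMod R) : Prop :=
  ∀ m, y (Ψ.castMod R m) = Ψ.castMod R (x m)

namespace IsBaseChange

variable {Ψ} {x x' : Ψ.EndMod ℤ} {y y' : Ψ.EndMod R}

theorem one : Ψ.IsBaseChange (1 : Ψ.EndMod ℤ) (1 : Ψ.EndMod R) :=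
  fun _ => rfl

theorem mul (h : Ψ.IsBaseChange x y) (h' : Ψ.IsBaseChange x' y') :
    Ψ.IsBaseChange (x * x') (y * y') :=
  fun m => by rw [Module.End.mul_apply, Module.End.mul_apply, h', h]

theorem add (h : Ψ.IsBaseChange x y) (h' : Ψ.IsBaseChange x' y') :
    Ψ.IsBaseChange (x + x') (y + y') :=
  fun m => by rw [LinearMap.add_apply, LinearMap.add_apply, h', h, map_add]

theorem sub (h : Ψ.IsBaseChange x y) (h' : Ψ.IsBaseChange x' y') :
    Ψ.IsBaseChange (x - x') (y - y') :=
  fun m => by rw [LinearMap.sub_apply, LinearMap.sub_apply, h', h, map_sub]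

theorem smul (c : ℤ) (h : Ψ.IsBaseChange x y) : Ψ.IsBaseChange (c • x) ((c : R) • y) :=
  fun m => by
    change (c : R) • y (Ψ.castMod R m) = Ψ.castMod R (c • x m)
    rw [h, map_zsmul, Int.cast_smul_eq_zsmul]

theorem eq (h : Ψ.IsBaseChange x y) (h' : Ψ.IsBaseChange x y') : y = y' :=
  Ψ.end_ext fun v _ => by rw [← castMod_zvec, h, h']

theorem eq_of_charZero [CharZero R] (h : Ψ.IsBaseChange x y) (h' : Ψ.IsBaseChange x' y) :
    x = x' :=
  LinearMap.ext fun m => Ψ.castMod_injective R (by rw [← h, ← h'])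

end IsBaseChange

theorem isBaseChange_of_zvec {x : Ψ.EndMod ℤ} {y : Ψ.EndMod R}
    (h : ∀ v ∈ Ψ.carrier, y (Ψ.zvec R v) = Ψ.castMod R (x (Ψ.zvec ℤ v))) :
    Ψ.IsBaseChange x y := by
  have : y.toAddMonoidHom.comp (Ψ.castMod R) = (Ψ.castMod R).comp x.toAddMonoidHom :=
    Ψ.addHom_ext fun v hv => by
      have := h v hv
      rw [← castMod_zvec] at this
      exact this
  exact fun m => DFunLike.congr_fun this m

theorem isBaseChange_e (i : b.support) : Ψ.IsBaseChange (Ψ.eEnd ℤ i) (Ψ.eEnd R i) := by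
  refine Ψ.isBaseChange_of_zvec fun v hv => ?_
  by_cases h : P.coroot' i v = -1
  · rw [Ψ.e_zvec R hv i h, Ψ.e_zvec ℤ hv i h, castMod_zvec]
  · rw [Ψ.e_zvec_of_ne R hv i h, Ψ.e_zvec_of_ne ℤ hv i h, map_zero]

theorem isBaseChange_f (i : b.support) : Ψ.IsBaseChange (Ψ.fEnd ℤ i) (Ψ.fEnd R i) := by
  refine Ψ.isBaseChange_of_zvec fun v hv => ?_
  by_cases h : P.coroot' i v = 1
  · rw [Ψ.f_zvec R hv i h, Ψ.f_zvec ℤ hv i h, castMod_zvec]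
  · rw [Ψ.f_zvec_of_ne R hv i h, Ψ.f_zvec_of_ne ℤ hv i h, map_zero]

theorem isBaseChange_n (i : b.support) :
    Ψ.IsBaseChange (Ψ.nUnit ℤ i).val (Ψ.nUnit R i).val := by
  rw [n_val, n_val]
  exact ((IsBaseChange.one.add (Ψ.isBaseChange_e i)).mul
    (IsBaseChange.one.sub (Ψ.isBaseChange_f i))).mul (IsBaseChange.one.add (Ψ.isBaseChange_e i))

theorem isBaseChange_n_inv (i : b.support) :
    Ψ.IsBaseChange (Ψ.nUnit ℤ i)⁻¹.val (Ψ.nUnit R i)⁻¹.val := by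
  rw [n_inv_val, n_inv_val]
  exact ((IsBaseChange.one.sub (Ψ.isBaseChange_e i)).mul
    (IsBaseChange.one.add (Ψ.isBaseChange_f i))).mul (IsBaseChange.one.sub (Ψ.isBaseChange_e i))

/-- Both `nᵢ` and `nᵢ⁻¹` are integral polynomials in `eᵢ` and `fᵢ`, so inverses descend to `ℤ` as
well. -/
theorem isBaseChange_prod (l : List b.support) :
    Ψ.IsBaseChange (l.map (Ψ.nUnit ℤ)).prod.val (l.map (Ψ.nUnit R)).prod.val ∧
    Ψ.IsBaseChange (l.map (Ψ.nUnit ℤ)).prod⁻¹.val (l.map (Ψ.nUnit R)).prod⁻¹.val := by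
  induction l with
  | nil => simpa using IsBaseChange.one
  | cons i l ih =>
    simp only [List.map_cons, List.prod_cons, mul_inv_rev, Units.val_mul]
    exact ⟨(Ψ.isBaseChange_n i).mul ih.1, ih.2.mul (Ψ.isBaseChange_n_inv i)⟩

variable (R) in
theorem isBaseChange_rootEnd (W : RootWords b) (a : ι) :
    Ψ.IsBaseChange (Ψ.rootEnd ℤ W a) (Ψ.rootEnd R W a) := by
  rw [rootEnd_eq, rootEnd_eq]
  exact ((Ψ.isBaseChange_prod _).1.mul (Ψ.isBaseChange_e _)).mul (Ψ.isBaseChange_prod _).2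

/-- An identity over `ℚ` that is defined over `ℤ` holds over every ring. -/
theorem IsBaseChange.transfer {x x' : Ψ.EndMod ℤ} {q q' : Ψ.EndMod ℚ}
    {y y' : Ψ.EndMod R} (hq : Ψ.IsBaseChange x q) (hq' : Ψ.IsBaseChange x' q')
    (hy : Ψ.IsBaseChange x y) (hy' : Ψ.IsBaseChange x' y') (h : q = q') : y = y' := by
  subst h
  obtain rfl := hq.eq_of_charZero hq'
  exact hy.eq hy'

end BaseChange

/-! ### Rank two Cartan integers. -/

section Pairings

variable [Finite ι] [P.IsCrystallographic] [P.IsReduced] [P.IsIrreducible]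

include Ψ in
/-- There are no minuscule weights in type `G₂`. -/
theorem isNotG2 : P.IsNotG2 := by
  rw [← RootPairing.not_isG2_iff_isNotG2, RootPairing.isG2_iff]
  rintro ⟨i, j, hij⟩
  obtain ⟨v, hv, hvi⟩ := Ψ.exists_coroot'_eq_neg_one i
  have h := Ψ.coroot'_cases hv (P.reflectionPerm i j)
  -- Adding the root `i` to `v` would shift the pairing with `j^∨` by `-3`, out of `{0, ±1}`.
  have hc : P.coroot' j (P.root i) = -3 := by
    rw [P.root_coroot'_eq_pairing, ← P.algebraMap_pairingIn ℤ, hij]; norm_num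
  rw [← P.coroot'_reflection, reflection_of_neg_one hvi, map_add, hc] at h
  rcases Ψ.coroot'_cases hv j with h' | h' | h' <;> rw [h'] at h <;> norm_num at h

include Ψ in
theorem coroot'_root_mem (i j : ι) :
    P.coroot' j (P.root i) ∈ ({-2, -1, 0, 1, 2} : Set ℚ) := by
  have := Ψ.isNotG2
  have h := RootPairing.IsNotG2.pairingIn_mem_zero_one_two (P := P) i j
  rw [P.root_coroot'_eq_pairing, ← P.algebraMap_pairingIn ℤ]
  simp only [Set.mem_insert_iff, Set.mem_singleton_iff] at h ⊢
  rcases h with h | h | h | h | h <;> simp [h]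

include Ψ in
theorem coroot'_root_le_two (i j : ι) : P.coroot' j (P.root i) ≤ 2 := by
  have := Ψ.coroot'_root_mem i j
  simp only [Set.mem_insert_iff, Set.mem_singleton_iff] at this
  rcases this with h | h | h | h | h <;> rw [h] <;> norm_num

include Ψ in
/-- The possible pairs of Cartan integers of non-proportional roots. -/
theorem coroot'_root_pair {i j : ι} (h : P.root j ≠ P.root i) (h' : P.root j ≠ -P.root i) :
    (P.coroot' i (P.root j), P.coroot' j (P.root i)) ∈
      ({(0, 0), (1, 1), (-1, -1), (1, 2), (2, 1), (-1, -2), (-2, -1)} : Set (ℚ × ℚ)) := by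
  have := Ψ.isNotG2
  have h1 := RootPairing.IsNotG2.pairingIn_mem_zero_one_two (P := P) i j
  have h2 := RootPairing.IsNotG2.pairingIn_mem_zero_one_two (P := P) j i
  have h3 := P.pairingIn_pairingIn_mem_set_of_isCrystal_of_isRed' j i h h'
  rw [P.root_coroot'_eq_pairing, P.root_coroot'_eq_pairing, ← P.algebraMap_pairingIn ℤ,
    ← P.algebraMap_pairingIn ℤ]
  simp only [Set.mem_insert_iff, Set.mem_singleton_iff, Prod.mk.injEq] at h1 h2 h3 ⊢
  rcases h3 with ⟨h, h'⟩ | ⟨h, h'⟩ | ⟨h, h'⟩ | ⟨h, h'⟩ | ⟨h, h'⟩ | ⟨h, h'⟩ | ⟨h, h'⟩ | ⟨h, h'⟩ |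
    ⟨h, h'⟩ | ⟨h, h'⟩ | ⟨h, h'⟩ <;> rw [h] at h2 ⊢ <;> rw [h'] at h1 ⊢ <;> first
      | (exfalso; norm_num at h1; done) | (exfalso; norm_num at h2; done) | norm_num

variable {α β γ δ : ι}

include Ψ in
/-- The possible pairs of Cartan integers of roots whose sum is a root. -/
theorem coroot'_root_pair_of_add (h : P.root β ≠ P.root α) (h' : P.root β ≠ -P.root α)
    (hγ : P.root γ = P.root α + P.root β) :
    (P.coroot' α (P.root β), P.coroot' β (P.root α)) ∈
      ({(0, 0), (-1, -1), (-1, -2), (-2, -1)} : Set (ℚ × ℚ)) := by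
  have h1 := Ψ.coroot'_root_pair h h'
  have h2 := Ψ.coroot'_root_le_two γ α
  rw [hγ, map_add, coroot'_root_self] at h2
  simp only [Set.mem_insert_iff, Set.mem_singleton_iff, Prod.mk.injEq] at h1 ⊢
  -- The root `α + β` pairs with `α^∨` to `2 + (β, α^∨)`, which is at most `2`.
  have h3 : P.coroot' α (P.root β) ≤ 0 := by linarith
  rcases h1 with h | h | h | h | h | h | h <;> rw [h.1] at h3 <;> norm_num at h3 <;> simp [h]

include Ψ in
theorem coroot'_root_of_two_add (h : P.root β ≠ P.root α) (h' : P.root β ≠ -P.root α)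
    (hδ : P.root δ = 2 • P.root α + P.root β) :
    P.coroot' α (P.root β) = -2 ∧ P.coroot' β (P.root α) = -1 := by
  have h1 := Ψ.coroot'_root_pair h h'
  have h2 := Ψ.coroot'_root_le_two δ α
  rw [hδ, map_add, map_nsmul, coroot'_root_self, nsmul_eq_mul] at h2
  simp only [Set.mem_insert_iff, Set.mem_singleton_iff, Prod.mk.injEq] at h1
  have h3 : P.coroot' α (P.root β) ≤ -2 := by push_cast at h2; linarith
  rcases h1 with h | h | h | h | h | h | h <;> rw [h.1] at h3 <;> norm_num at h3
  exact h

omit [Finite ι] [P.IsCrystallographic] [P.IsReduced] [P.IsIrreducible] in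
theorem two_add_mem_range (h : P.coroot' α (P.root β) = -2) :
    2 • P.root α + P.root β ∈ Set.range P.root :=
  ⟨P.reflectionPerm α β, by rw [P.root_reflectionPerm, P.reflection_apply, h]; module⟩

end Pairings

/-! ### Structure constants over `ℚ`. -/

section StructureConstants

variable {R : Type*} [CommRing R] {x y : Module.End R (Ψ.Mod R)} {α β γ δ : ι}

theorem ActsAsRoot.mul_zvec (hx : Ψ.ActsAsRoot x α) (hy : Ψ.ActsAsRoot y β) {v : E}
    (hv : v ∈ Ψ.carrier) (h1 : P.coroot' β v = -1)
    (h2 : P.coroot' α v + P.coroot' α (P.root β) = -1) :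
    ∃ ε : R, (ε = 1 ∨ ε = -1) ∧
      (x * y) (Ψ.zvec R v) = ε • Ψ.zvec R (v + P.root β + P.root α) := by
  obtain ⟨ε, hε, he⟩ := (hy v hv).1 h1
  rw [← map_add] at h2
  obtain ⟨ε', hε', he'⟩ := (hx _ (Ψ.add_root_mem hv h1)).1 h2
  refine ⟨ε * ε', ?_, by rw [Module.End.mul_apply, he, map_smul, he', smul_smul]⟩
  rcases hε with rfl | rfl <;> rcases hε' with rfl | rfl <;> simp

/-- If `(β, α^∨) ≠ -2` then `𝐞_α 𝐞_β 𝐞_α = 0`. -/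
theorem ActsAsRoot.mul_mul_eq_zero (hx : Ψ.ActsAsRoot x α) (hy : Ψ.ActsAsRoot y β)
    (h : P.coroot' α (P.root β) ≠ -2) : x * y * x = 0 := by
  refine Ψ.end_ext fun v hv => ?_
  rw [LinearMap.zero_apply, Module.End.mul_apply]
  by_cases h1 : P.coroot' α v = -1
  · obtain ⟨ε, -, he⟩ := (hx v hv).1 h1
    have hm := Ψ.add_root_mem hv h1
    rw [he, map_smul, Module.End.mul_apply]
    by_cases h2 : P.coroot' β (v + P.root α) = -1
    · obtain ⟨ε', -, he'⟩ := (hy _ hm).1 h2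
      rw [he', map_smul, (hx _ (Ψ.add_root_mem hm h2)).2, smul_zero, smul_zero]
      -- The last factor survives only if `-1 + 2 + (β, α^∨) = -1`.
      rw [map_add, map_add, h1, coroot'_root_self]
      intro h3
      exact h (by linarith)
    · rw [(hy _ hm).2 h2, map_zero, smul_zero]
  · rw [(hx v hv).2 h1, map_zero]

theorem eq_one_or_neg_one_of_smul_zvec {c ε ε' : ℚ} (hε : ε = 1 ∨ ε = -1)
    (hε' : ε' = 1 ∨ ε' = -1) {v : E} (hv : v ∈ Ψ.carrier)
    (h : ε' • Ψ.zvec ℚ v = c • ε • Ψ.zvec ℚ v) : c = 1 ∨ c = -1 := by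
  rw [smul_smul] at h
  have h' := smul_left_injective ℚ (Ψ.zvec_ne_zero ℚ hv) h
  rcases hε with rfl | rfl <;> rcases hε' with rfl | rfl
  · left; linarith
  · right; linarith
  · right; linarith
  · left; linarith

variable [Finite ι] [P.IsCrystallographic] [P.IsReduced] [P.IsIrreducible] [P.IsRootSystem]
  (W : RootWords b)

omit [P.IsReduced] in
-- Here `γ = s_α(β)`. At a `z_v` with `(v, γ^∨) = -1`, exactly one of the two products in the
-- commutator is nonzero, so the scalar is a sign.
theorem lie_eq_smul_of_neg_one (hp : P.coroot' α (P.root β) = -1)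
    (hq : P.coroot' β (P.root α) = -1 ∨ P.coroot' β (P.root α) = -2)
    (hγ : P.root γ = P.root α + P.root β) :
    ∃ c : ℚ, (c = 1 ∨ c = -1) ∧
      ⁅Ψ.rootEnd ℚ W α, Ψ.rootEnd ℚ W β⁆ = c • Ψ.rootEnd ℚ W γ := by
  have hα := Ψ.actsAsRoot_rootVector (R := ℚ) W α
  have hβ := Ψ.actsAsRoot_rootVector (R := ℚ) W β
  obtain ⟨c, hc⟩ := Ψ.eq_smul_rootEnd_of_hasWeight W
    (Ψ.lie_rootEnd_mem_lieSpan W α (Ψ.rootEnd_mem_lieSpan W β)) (a := γ)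
    (by rw [hγ]; exact HasWeight.lie Ψ hα.hasWeight hβ.hasWeight)
  refine ⟨c, ?_, hc⟩
  obtain ⟨v, hv, hvγ⟩ := Ψ.exists_coroot'_eq_neg_one γ
  obtain ⟨ε, hε, he⟩ := ((Ψ.actsAsRoot_rootVector (R := ℚ) W γ) v hv).1 hvγ
  have hm := Ψ.add_root_mem hv hvγ
  have hγ' : γ = P.reflectionPerm α β := P.root.injective (by
    rw [hγ, P.root_reflectionPerm, P.reflection_apply, hp]; module)
  rw [hγ', ← P.coroot'_reflection, P.reflection_apply, map_sub, map_smul, smul_eq_mul] at hvγ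
  have key : ∃ ε' : ℚ, (ε' = 1 ∨ ε' = -1) ∧
      ⁅Ψ.rootEnd ℚ W α, Ψ.rootEnd ℚ W β⁆ (Ψ.zvec ℚ v) = ε' • Ψ.zvec ℚ (v + P.root γ) := by
    have hcase : (P.coroot' α v = 0 ∧ P.coroot' β v = -1) ∨
        (P.coroot' α v = -1 ∧ P.coroot' β v + P.coroot' β (P.root α) = -1 ∧
          P.coroot' β v ≠ -1) := by
      rcases hq with hq | hq <;> rw [hq] at hvγ ⊢ <;>
        rcases Ψ.coroot'_cases hv α with h | h | h <;>
        rcases Ψ.coroot'_cases hv β with h' | h' | h' <;> rw [h, h'] at hvγ ⊢ <;> norm_num at hvγ <;> norm_num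
    rw [Ring.lie_def, LinearMap.sub_apply]
    rcases hcase with ⟨h1, h2⟩ | ⟨h1, h2, h3⟩
    · obtain ⟨ε', hε', he'⟩ := ActsAsRoot.mul_zvec Ψ hα hβ hv h2 (by rw [h1, hp]; norm_num)
      refine ⟨ε', hε', ?_⟩
      rw [he', Module.End.mul_apply, (hα v hv).2 (by rw [h1]; norm_num), map_zero, sub_zero, hγ]
      congr 2
      abel
    · obtain ⟨ε', hε', he'⟩ := ActsAsRoot.mul_zvec Ψ hβ hα hv h1 h2
      refine ⟨-ε', by rcases hε' with rfl | rfl <;> simp, ?_⟩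
      rw [he', Module.End.mul_apply, (hβ v hv).2 h3, map_zero, zero_sub, hγ, neg_smul, add_assoc]
  obtain ⟨ε', hε', he'⟩ := key
  rw [hc, LinearMap.smul_apply, he] at he'
  exact Ψ.eq_one_or_neg_one_of_smul_zvec hε hε' hm he'.symm

omit [P.IsReduced] in
theorem mul_mul_eq_smul_of_neg_two (hp : P.coroot' α (P.root β) = -2)
    (hq : P.coroot' β (P.root α) = -1) (hδ : P.root δ = 2 • P.root α + P.root β) :
    ∃ c : ℚ, (c = 1 ∨ c = -1) ∧
      Ψ.rootEnd ℚ W α * Ψ.rootEnd ℚ W β * Ψ.rootEnd ℚ W α = c • Ψ.rootEnd ℚ W δ := by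
  have hα := Ψ.actsAsRoot_rootVector (R := ℚ) W α
  have hβ := Ψ.actsAsRoot_rootVector (R := ℚ) W β
  have hmem : Ψ.rootEnd ℚ W α * Ψ.rootEnd ℚ W β * Ψ.rootEnd ℚ W α ∈ Ψ.lieSpan := by
    -- An associative product need not lie in `lieSpan`; this one does, being a multiple of an
    -- iterated bracket.
    have h1 : Ψ.rootEnd ℚ W α * Ψ.rootEnd ℚ W β * Ψ.rootEnd ℚ W α =
        (-1 / 2 : ℚ) • ⁅Ψ.rootEnd ℚ W α, ⁅Ψ.rootEnd ℚ W α, Ψ.rootEnd ℚ W β⁆⁆ := by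
      have h0 := Ψ.rootEnd_mul_self ℚ W α
      have h : ∀ w, Ψ.rootEnd ℚ W α * (Ψ.rootEnd ℚ W α * w) = 0 := fun w => by
        rw [← mul_assoc, h0, zero_mul]
      simp only [Ring.lie_def, mul_sub, sub_mul, mul_assoc, h, h0, mul_zero]
      module
    rw [h1]
    exact Submodule.smul_mem _ _ (Ψ.lie_rootEnd_mem_lieSpan W α
      (Ψ.lie_rootEnd_mem_lieSpan W α (Ψ.rootEnd_mem_lieSpan W β)))
  obtain ⟨c, hc⟩ := Ψ.eq_smul_rootEnd_of_hasWeight W hmem (a := δ) (by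
    have := HasWeight.mul Ψ (HasWeight.mul Ψ hα.hasWeight hβ.hasWeight) hα.hasWeight
    convert this using 1
    rw [hδ]; congr 1; abel)
  refine ⟨c, ?_, hc⟩
  obtain ⟨v, hv, hvδ⟩ := Ψ.exists_coroot'_eq_neg_one δ
  obtain ⟨ε, hε, he⟩ := ((Ψ.actsAsRoot_rootVector (R := ℚ) W δ) v hv).1 hvδ
  have hm := Ψ.add_root_mem hv hvδ
  have hδ' : δ = P.reflectionPerm α β := P.root.injective (by
    rw [hδ, P.root_reflectionPerm, P.reflection_apply, hp]; module)
  rw [hδ', ← P.coroot'_reflection, P.reflection_apply, map_sub, map_smul, smul_eq_mul, hq] at hvδ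
  -- The coroot of `s_β(α)` takes the value `(v, α^∨) + 2(v, β^∨)` on `v`; this rules out the
  -- alternative `(v, α^∨) = 0`, `(v, β^∨) = -1`.
  have hsum := Ψ.coroot'_cases hv (P.reflectionPerm β α)
  rw [← P.coroot'_reflection, P.reflection_apply, map_sub, map_smul, smul_eq_mul, hp] at hsum
  have hcase : P.coroot' α v = -1 ∧ P.coroot' β v = 0 := by
    rcases Ψ.coroot'_cases hv α with h | h | h <;>
      rcases Ψ.coroot'_cases hv β with h' | h' | h' <;> rw [h, h'] at hvδ hsum ⊢ <;>
      first
        | (exfalso; norm_num at hvδ; done) | (exfalso; norm_num at hsum; done) | norm_num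
  obtain ⟨h1, h2⟩ := hcase
  obtain ⟨ε₁, hε₁, he₁⟩ := (hα v hv).1 h1
  obtain ⟨ε₂, hε₂, he₂⟩ := ActsAsRoot.mul_zvec Ψ hα hβ (Ψ.add_root_mem hv h1)
    (by rw [map_add, h2, hq]; norm_num) (by rw [map_add, h1, coroot'_root_self, hp]; norm_num)
  have hprod := LinearMap.congr_fun hc (Ψ.zvec ℚ v)
  rw [Module.End.mul_apply, he₁, map_smul, he₂, smul_smul, LinearMap.smul_apply, he,
    show v + P.root α + P.root β + P.root α = v + P.root δ by rw [hδ]; module] at hprod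
  refine Ψ.eq_one_or_neg_one_of_smul_zvec hε ?_ hm hprod
  rcases hε₁ with rfl | rfl <;> rcases hε₂ with rfl | rfl <;> simp

/-- With `δ = α - β`, a root, `𝐞_α = ±[𝐞_δ, 𝐞_β]`. Hence `[𝐞_α, 𝐞_β]` is `±[[𝐞_δ, 𝐞_β], 𝐞_β] = ∓2
𝐞_β 𝐞_δ 𝐞_β`, which is `±2 𝐞_γ`. -/
theorem lie_eq_smul_of_zero (hq : P.coroot' β (P.root α) = 0)
    (hγ : P.root γ = P.root α + P.root β) :
    ∃ c : ℚ, (c = 2 ∨ c = -2) ∧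
      ⁅Ψ.rootEnd ℚ W α, Ψ.rootEnd ℚ W β⁆ = c • Ψ.rootEnd ℚ W γ := by
  obtain ⟨δ, hδ⟩ : ∃ δ, P.root δ = P.root α - P.root β := by
    -- `s_β(α + β) = α - β` because `(α, β^∨) = 0`.
    refine ⟨P.reflectionPerm β γ, ?_⟩
    rw [P.root_reflectionPerm, P.reflection_apply, hγ, map_add, hq, coroot'_root_self]
    module
  have hβδ : P.coroot' β (P.root δ) = -2 := by
    rw [hδ, map_sub, hq, coroot'_root_self]; norm_num
  have hδβ : P.coroot' δ (P.root β) = -1 := by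
    have h := Ψ.coroot'_root_pair (i := β) (j := δ) (fun h => ?_) (fun h => ?_)
    · simp only [Set.mem_insert_iff, Set.mem_singleton_iff, Prod.mk.injEq, hβδ] at h
      norm_num at h
      exact h
    · rw [h, coroot'_root_self] at hβδ
      norm_num at hβδ
    · rw [hδ, sub_eq_iff_eq_add, neg_add_cancel] at h
      exact P.ne_zero _ h
  obtain ⟨c₁, hc₁, h1⟩ := Ψ.lie_eq_smul_of_neg_one W hδβ (Or.inr hβδ) (γ := α)
    (by rw [hδ]; module)
  obtain ⟨c₂, hc₂, h2⟩ := Ψ.mul_mul_eq_smul_of_neg_two W hβδ hδβ (δ := γ)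
    (by rw [hδ, hγ]; module)
  have hββ := Ψ.rootEnd_mul_self ℚ W β
  have hββ' : ∀ w, Ψ.rootEnd ℚ W β * (Ψ.rootEnd ℚ W β * w) = 0 := fun w => by
    rw [← mul_assoc, hββ, zero_mul]
  have h3 : Ψ.rootEnd ℚ W α = c₁ • ⁅Ψ.rootEnd ℚ W δ, Ψ.rootEnd ℚ W β⁆ := by
    rw [h1, smul_smul]
    rcases hc₁ with rfl | rfl <;> norm_num
  have h4 : ⁅⁅Ψ.rootEnd ℚ W δ, Ψ.rootEnd ℚ W β⁆, Ψ.rootEnd ℚ W β⁆ =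
      (-2 : ℚ) • (Ψ.rootEnd ℚ W β * Ψ.rootEnd ℚ W δ * Ψ.rootEnd ℚ W β) := by
    simp only [Ring.lie_def, mul_sub, sub_mul, mul_assoc, hββ, hββ', mul_zero]
    module
  refine ⟨c₁ * -2 * c₂, ?_, ?_⟩
  · rcases hc₁ with rfl | rfl <;> rcases hc₂ with rfl | rfl <;> norm_num
  · rw [h3, smul_lie, h4, h2, smul_smul, smul_smul, mul_assoc]

/-- The structure constants over `ℚ`. -/
theorem exists_lie_eq_smul (hne : P.root β ≠ P.root α) (hne' : P.root β ≠ -P.root α)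
    (hγ : P.root γ = P.root α + P.root β) :
    ∃ c : ℤ, c ∈ ({1, -1, 2, -2} : Set ℤ) ∧
      ⁅Ψ.rootEnd ℚ W α, Ψ.rootEnd ℚ W β⁆ = (c : ℚ) • Ψ.rootEnd ℚ W γ := by
  have h := Ψ.coroot'_root_pair_of_add hne hne' hγ
  simp only [Set.mem_insert_iff, Set.mem_singleton_iff, Prod.mk.injEq] at h ⊢
  have key : ∃ c : ℚ, (c = 1 ∨ c = -1 ∨ c = 2 ∨ c = -2) ∧
      ⁅Ψ.rootEnd ℚ W α, Ψ.rootEnd ℚ W β⁆ = c • Ψ.rootEnd ℚ W γ := by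
    rcases h with ⟨-, hq⟩ | ⟨hp, hq⟩ | ⟨hp, hq⟩ | ⟨hp, hq⟩
    · obtain ⟨c, hc, h⟩ := Ψ.lie_eq_smul_of_zero W hq hγ
      exact ⟨c, by tauto, h⟩
    · obtain ⟨c, hc, h⟩ := Ψ.lie_eq_smul_of_neg_one W hp (Or.inl hq) hγ
      exact ⟨c, by tauto, h⟩
    · obtain ⟨c, hc, h⟩ := Ψ.lie_eq_smul_of_neg_one W hp (Or.inr hq) hγ
      exact ⟨c, by tauto, h⟩
    · obtain ⟨c, hc, h⟩ := Ψ.lie_eq_smul_of_neg_one W hq (Or.inr hp) (by rw [hγ, add_comm])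
      exact ⟨-c, by rcases hc with rfl | rfl <;> norm_num, by rw [← lie_skew, h, neg_smul]⟩
  obtain ⟨c, hc, h⟩ := key
  rcases hc with rfl | rfl | rfl | rfl
  · exact ⟨1, by simp, by simpa using h⟩
  · exact ⟨-1, by simp, by simpa using h⟩
  · exact ⟨2, by simp, by simpa using h⟩
  · exact ⟨-2, by simp, by simpa using h⟩

theorem exists_mul_mul_eq_smul (hne : P.root β ≠ P.root α) (hne' : P.root β ≠ -P.root α)
    (hδ : P.root δ = 2 • P.root α + P.root β) :
    ∃ c : ℤ, c ∈ ({1, -1} : Set ℤ) ∧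
      Ψ.rootEnd ℚ W α * Ψ.rootEnd ℚ W β * Ψ.rootEnd ℚ W α = (c : ℚ) • Ψ.rootEnd ℚ W δ := by
  obtain ⟨hp, hq⟩ := Ψ.coroot'_root_of_two_add hne hne' hδ
  obtain ⟨c, hc, h⟩ := Ψ.mul_mul_eq_smul_of_neg_two W hp hq hδ
  rcases hc with rfl | rfl
  · exact ⟨1, by simp, by simpa using h⟩
  · exact ⟨-1, by simp, by simpa using h⟩

omit [P.IsReduced] [P.IsIrreducible] in
-- Positivity makes `α + β` a nonempty sum of simple roots, so a nonzero bracket would force it to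
-- be a root.
theorem lie_eq_zero_of_add_notMem (hα : b.IsPos α) (hβ : b.IsPos β)
    (h : P.root α + P.root β ∉ Set.range P.root) :
    ⁅Ψ.rootEnd ℚ W α, Ψ.rootEnd ℚ W β⁆ = 0 := by
  by_contra hne
  obtain ⟨l, hl, hlα⟩ := exists_root_eq_listWeight hα
  obtain ⟨m, -, hmβ⟩ := exists_root_eq_listWeight hβ
  have hw := HasWeight.lie Ψ (Ψ.actsAsRoot_rootVector (R := ℚ) W α).hasWeight
    (Ψ.actsAsRoot_rootVector (R := ℚ) W β).hasWeight
  rw [hlα, hmβ, ← listWeight_append] at hw h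
  exact h (Ψ.listWeight_mem_range_of_ne_zero
    (Ψ.lie_rootEnd_mem_lieSpan W α (Ψ.rootEnd_mem_lieSpan W β)) hne (by simp [hl]) hw)

end StructureConstants

end MinusculeSet

/-! ### Formal identities for square-zero elements. -/

section Commutators

variable {R A : Type*} [CommRing R] [Ring A] [Algebra R A] {a b g d : A} {c c' t u : R}

/-- Commutator formula for square-zero elements with `aba = bab = 0`. -/
theorem conj_eq_mul (ha : a * a = 0) (hb : b * b = 0) (haba : a * b * a = 0)
    (hbab : b * a * b = 0) (hg : a * b - b * a = c • g) :
    (1 + (-u) • b) * (1 + t • a) * (1 + u • b) = (1 + t • a) * (1 + (c * t * u) • g) := by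
  have hg' : (c * t * u) • g = (t * u) • (a * b - b * a) := by rw [hg]; module
  have ha' : ∀ w, a * (a * w) = 0 := fun w => by rw [← mul_assoc, ha, zero_mul]
  rw [mul_assoc] at haba hbab
  rw [hg']
  simp only [mul_add, add_mul, mul_sub, smul_mul_assoc, mul_smul_comm, mul_one, one_mul,
    mul_assoc, haba, hbab, hb, ha', smul_zero]
  module

/-- Commutator formula for square-zero elements with `aba = 0`. -/
theorem conj_eq_mul_mul_of_left (ha : a * a = 0) (hb : b * b = 0) (haba : a * b * a = 0)
    (hg : a * b - b * a = c • g) (hd : b * a * b = c' • d) :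
    (1 + (-u) • b) * (1 + t • a) * (1 + u • b) =
      (1 + t • a) * (1 + (c * t * u) • g) * (1 + (-c' * t * u ^ 2) • d) ∧
    Commute (1 + t • a) (1 + (c * t * u) • g) ∧
    Commute (1 + t • a) (1 + (-c' * t * u ^ 2) • d) ∧
    Commute (1 + (c * t * u) • g) (1 + (-c' * t * u ^ 2) • d) := by
  have hg' : (c * t * u) • g = (t * u) • (a * b - b * a) := by rw [hg]; module
  have hd' : (-c' * t * u ^ 2) • d = -(t * u ^ 2) • (b * a * b) := by rw [hd]; module
  have ha' : ∀ w, a * (a * w) = 0 := fun w => by rw [← mul_assoc, ha, zero_mul]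
  have hb' : ∀ w, b * (b * w) = 0 := fun w => by rw [← mul_assoc, hb, zero_mul]
  have haba' : ∀ w, a * (b * (a * w)) = 0 := fun w => by
    rw [← mul_assoc, ← mul_assoc, haba, zero_mul]
  rw [mul_assoc] at haba
  rw [hg', hd', commute_iff_eq, commute_iff_eq, commute_iff_eq]
  simp only [mul_add, add_mul, mul_sub, sub_mul, smul_mul_assoc, mul_smul_comm, mul_one, one_mul,
    mul_assoc, haba, haba', ha, hb, ha', hb', smul_zero, mul_zero]
  refine ⟨?_, ?_, ?_, ?_⟩ <;> module

/-- Commutator formula for square-zero elements with `bab = 0`. -/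
theorem conj_eq_mul_mul_of_right (ha : a * a = 0) (hb : b * b = 0) (hbab : b * a * b = 0)
    (hg : a * b - b * a = c • g) (hd : a * b * a = c' • d) :
    (1 + (-u) • b) * (1 + t • a) * (1 + u • b) =
      (1 + t • a) * (1 + (c * t * u) • g) * (1 + (c' * t ^ 2 * u) • d) := by
  -- Multiplying `1 + ta` by `1 + tu(ab - ba)` creates `-t²u·aba`; the factor with `d` cancels it,
  -- whence the sign opposite to that in `conj_eq_mul_mul_of_left`.
  have hg' : (c * t * u) • g = (t * u) • (a * b - b * a) := by rw [hg]; module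
  have hd' : (c' * t ^ 2 * u) • d = (t ^ 2 * u) • (a * b * a) := by rw [hd]; module
  have ha' : ∀ w, a * (a * w) = 0 := fun w => by rw [← mul_assoc, ha, zero_mul]
  have hbab' : ∀ w, b * (a * (b * w)) = 0 := fun w => by
    rw [← mul_assoc, ← mul_assoc, hbab, zero_mul]
  rw [mul_assoc] at hbab
  rw [hg', hd']
  simp only [mul_add, add_mul, mul_sub, sub_mul, smul_mul_assoc, mul_smul_comm, mul_one, one_mul,
    mul_assoc, hbab, hbab', hb, ha', smul_zero, mul_zero, zero_mul]
  module

theorem commute_one_add_smul (h : a * b = b * a) :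
    (1 + t • a) * (1 + u • b) = (1 + u • b) * (1 + t • a) := by
  simp only [mul_add, add_mul, smul_mul_assoc, mul_smul_comm, mul_one, one_mul, h]
  module

end Commutators

/-! ### Transfer of the relations to `R`, and uniqueness of the scalars. -/

namespace MinusculeSet

variable {b : P.Base} (Ψ : MinusculeSet b) (W : RootWords b) (R : Type*) [CommRing R]

theorem ext_xRoot {x y : Ψ.chevalleyGroup R}
    (h : ((x.1.val : Module.End R (Ψ.FreeMod R)) : Ψ.EndMod R) = y.1.val) : x = y :=
  Subtype.ext (Units.ext h)

variable {Ψ W R} {α β γ δ : ι} {c : ℤ}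

theorem lie_eq_of_rat
    (h : ⁅Ψ.rootEnd ℚ W α, Ψ.rootEnd ℚ W β⁆ = (c : ℚ) • Ψ.rootEnd ℚ W γ) :
    Ψ.rootEnd R W α * Ψ.rootEnd R W β - Ψ.rootEnd R W β * Ψ.rootEnd R W α =
      (c : R) • Ψ.rootEnd R W γ :=
  IsBaseChange.transfer Ψ
    (((Ψ.isBaseChange_rootEnd ℚ W α).mul (Ψ.isBaseChange_rootEnd ℚ W β)).sub
      ((Ψ.isBaseChange_rootEnd ℚ W β).mul (Ψ.isBaseChange_rootEnd ℚ W α)))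
    ((Ψ.isBaseChange_rootEnd ℚ W γ).smul c)
    (((Ψ.isBaseChange_rootEnd R W α).mul (Ψ.isBaseChange_rootEnd R W β)).sub
      ((Ψ.isBaseChange_rootEnd R W β).mul (Ψ.isBaseChange_rootEnd R W α)))
    ((Ψ.isBaseChange_rootEnd R W γ).smul c) h

theorem mul_comm_of_rat (h : ⁅Ψ.rootEnd ℚ W α, Ψ.rootEnd ℚ W β⁆ = 0) :
    Ψ.rootEnd R W α * Ψ.rootEnd R W β = Ψ.rootEnd R W β * Ψ.rootEnd R W α := by
  have := lie_eq_of_rat (R := R) (γ := α) (c := 0) (by simpa using h)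
  rwa [Int.cast_zero, zero_smul, sub_eq_zero] at this

theorem mul_mul_eq_of_rat (h : Ψ.rootEnd ℚ W α * Ψ.rootEnd ℚ W β * Ψ.rootEnd ℚ W α =
      (c : ℚ) • Ψ.rootEnd ℚ W δ) :
    Ψ.rootEnd R W α * Ψ.rootEnd R W β * Ψ.rootEnd R W α = (c : R) • Ψ.rootEnd R W δ :=
  IsBaseChange.transfer Ψ
    (((Ψ.isBaseChange_rootEnd ℚ W α).mul (Ψ.isBaseChange_rootEnd ℚ W β)).mul
      (Ψ.isBaseChange_rootEnd ℚ W α))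
    ((Ψ.isBaseChange_rootEnd ℚ W δ).smul c)
    (((Ψ.isBaseChange_rootEnd R W α).mul (Ψ.isBaseChange_rootEnd R W β)).mul
      (Ψ.isBaseChange_rootEnd R W α))
    ((Ψ.isBaseChange_rootEnd R W δ).smul c) h

variable (Ψ W) in
theorem rootEnd_ne_zero [Nontrivial R] [P.IsIrreducible] (a : ι) : Ψ.rootEnd R W a ≠ 0 := by
  intro h
  obtain ⟨v, hv, hva⟩ := Ψ.exists_coroot'_eq_neg_one a
  obtain ⟨ε, hε, he⟩ := (Ψ.actsAsRoot_rootVector (R := R) W a v hv).1 hva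
  rw [h, LinearMap.zero_apply] at he
  have := Ψ.zvec_ne_zero R (Ψ.add_root_mem hv hva)
  rcases hε with rfl | rfl <;> exact this (by simpa using he.symm)

theorem eq_smul_rootEnd_iff {K : Type*} [Field K] [P.IsIrreducible] {x : Ψ.EndMod K} {a : ι}
    {d z : K} (h : x = d • Ψ.rootEnd K W a) : x = z • Ψ.rootEnd K W a ↔ z = d := by
  rw [h]
  exact ⟨fun h' => (smul_left_injective K (Ψ.rootEnd_ne_zero W a) h').symm, fun h' => by rw [h']⟩

end MinusculeSet

end MinusculeChevalley

end

open MinusculeChevalley in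
theorem proposition3p2 {ι E N : Type*} [Finite ι] [AddCommGroup E] [Module ℚ E]
    [AddCommGroup N] [Module ℚ N] (P : RootPairing ι ℚ E N) [P.IsRootSystem]
    [P.IsCrystallographic] [P.IsReduced] [P.IsIrreducible] (b : P.Base)
    (Ψ : MinusculeSet b) (W : RootWords b) (α β : ι) (hα : b.IsPos α) (hβ : b.IsPos β)
    (hne : P.root β ≠ P.root α) (hne' : P.root β ≠ -P.root α) :
    -- the case `α + β ∉ Φ`
    (P.root α + P.root β ∉ Set.range P.root →
      ∀ (R : Type*) [CommRing R] (t u : R),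
        Ψ.xRoot W R α t * Ψ.xRoot W R β u = Ψ.xRoot W R β u * Ψ.xRoot W R α t) ∧
    -- the case `α + β = γ ∈ Φ`
    (∀ γ : ι, P.root γ = P.root α + P.root β →
      -- `c` is the unique scalar with `[𝐞_α, 𝐞_β] = c 𝐞_{α+β}` over `ℂ`
      ∃ c : ℤ, c ∈ ({1, -1, 2, -2} : Set ℤ) ∧
        (∀ z : ℂ, ⁅Ψ.rootVector W ℂ α, Ψ.rootVector W ℂ β⁆ = z • Ψ.rootVector W ℂ γ ↔
          z = (c : ℂ)) ∧
        -- (a)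
        (2 • P.root α + P.root β ∉ Set.range P.root →
          P.root α + 2 • P.root β ∉ Set.range P.root →
          ∀ (R : Type*) [CommRing R] (t u : R),
            Ψ.xRoot W R β (-u) * Ψ.xRoot W R α t * Ψ.xRoot W R β u =
              Ψ.xRoot W R α t * Ψ.xRoot W R γ (c * t * u)) ∧
        -- (b), with `α + 2β = δ ∈ Φ`
        (2 • P.root α + P.root β ∉ Set.range P.root →
          ∀ δ : ι, P.root δ = P.root α + 2 • P.root β →
          ∃ c' : ℤ, c' ∈ ({1, -1} : Set ℤ) ∧
            (∀ z : ℂ, Ψ.rootVector W ℂ β * Ψ.rootVector W ℂ α * Ψ.rootVector W ℂ β =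
              z • Ψ.rootVector W ℂ δ ↔ z = (c' : ℂ)) ∧
            ∀ (R : Type*) [CommRing R] (t u : R),
              Ψ.xRoot W R β (-u) * Ψ.xRoot W R α t * Ψ.xRoot W R β u =
                Ψ.xRoot W R α t * Ψ.xRoot W R γ (c * t * u) * Ψ.xRoot W R δ (-c' * t * u ^ 2) ∧
              Commute (Ψ.xRoot W R α t) (Ψ.xRoot W R γ (c * t * u)) ∧
              Commute (Ψ.xRoot W R α t) (Ψ.xRoot W R δ (-c' * t * u ^ 2)) ∧
              Commute (Ψ.xRoot W R γ (c * t * u)) (Ψ.xRoot W R δ (-c' * t * u ^ 2))) ∧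
        -- (c), with `2α + β = δ ∈ Φ`
        (∀ δ : ι, P.root δ = 2 • P.root α + P.root β →
          P.root α + 2 • P.root β ∉ Set.range P.root ∧
          ∃ c'' : ℤ, c'' ∈ ({1, -1} : Set ℤ) ∧
            (∀ z : ℂ, Ψ.rootVector W ℂ α * Ψ.rootVector W ℂ β * Ψ.rootVector W ℂ α =
              z • Ψ.rootVector W ℂ δ ↔ z = (c'' : ℂ)) ∧
            ∀ (R : Type*) [CommRing R] (t u : R),
              Ψ.xRoot W R β (-u) * Ψ.xRoot W R α t * Ψ.xRoot W R β u =
                Ψ.xRoot W R α t * Ψ.xRoot W R γ (c * t * u) *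
                  Ψ.xRoot W R δ (c'' * t ^ 2 * u))) := by
  have hne'' : P.root α ≠ -P.root β := fun h => hne' (by rw [h, neg_neg])
  refine ⟨fun h R _ t u => ?_, fun γ hγ => ?_⟩
  · exact Ψ.ext_xRoot R (commute_one_add_smul
      (MinusculeSet.mul_comm_of_rat (Ψ.lie_eq_zero_of_add_notMem W hα hβ h)))
  obtain ⟨c, hc, hlie⟩ := Ψ.exists_lie_eq_smul W hne hne' hγ
  refine ⟨c, hc, fun z => ?_, fun h1 h2 R _ t u => ?_, fun h1 δ hδ => ?_, fun δ hδ => ?_⟩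
  · exact MinusculeSet.eq_smul_rootEnd_iff (MinusculeSet.lie_eq_of_rat (R := ℂ) hlie)
  -- If `(β, α^∨)` were `-2`, then `s_α(β) = 2α + β` would be a root; so `aba = 0`, and likewise
  -- `bab = 0`.
  · exact Ψ.ext_xRoot R (conj_eq_mul (Ψ.rootEnd_mul_self R W α) (Ψ.rootEnd_mul_self R W β)
      (MinusculeSet.ActsAsRoot.mul_mul_eq_zero Ψ (Ψ.actsAsRoot_rootVector W α)
        (Ψ.actsAsRoot_rootVector W β) fun h => h1 (MinusculeSet.two_add_mem_range h))
      (MinusculeSet.ActsAsRoot.mul_mul_eq_zero Ψ (Ψ.actsAsRoot_rootVector W β)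
        (Ψ.actsAsRoot_rootVector W α) fun h => h2 (by
          rw [add_comm]; exact MinusculeSet.two_add_mem_range h))
      (MinusculeSet.lie_eq_of_rat hlie))
  · obtain ⟨c', hc', hmul⟩ := Ψ.exists_mul_mul_eq_smul W hne.symm hne'' (δ := δ)
      (by rw [hδ, add_comm])
    refine ⟨c', hc', fun z => ?_, fun R _ t u => ?_⟩
    · exact MinusculeSet.eq_smul_rootEnd_iff (MinusculeSet.mul_mul_eq_of_rat (R := ℂ) hmul)
    · obtain ⟨k1, k2, k3, k4⟩ := conj_eq_mul_mul_of_left (t := t) (u := u)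
        (Ψ.rootEnd_mul_self R W α)
        (Ψ.rootEnd_mul_self R W β)
        (MinusculeSet.ActsAsRoot.mul_mul_eq_zero Ψ (Ψ.actsAsRoot_rootVector W α)
          (Ψ.actsAsRoot_rootVector W β) fun h => h1 (MinusculeSet.two_add_mem_range h))
        (MinusculeSet.lie_eq_of_rat hlie) (MinusculeSet.mul_mul_eq_of_rat hmul)
      exact ⟨Ψ.ext_xRoot R k1, Ψ.ext_xRoot R k2, Ψ.ext_xRoot R k3, Ψ.ext_xRoot R k4⟩
  · obtain ⟨hp, hq⟩ := Ψ.coroot'_root_of_two_add hne hne' hδ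
    obtain ⟨c', hc', hmul⟩ := Ψ.exists_mul_mul_eq_smul W hne hne' hδ
    refine ⟨?_, c', hc', fun z => ?_, fun R _ t u => ?_⟩
    · rintro ⟨ε, hε⟩
      -- `α + 2β ∈ Φ` would force `(α, β^∨) = -2`, whereas `2α + β ∈ Φ` forces `-1`.
      have := (Ψ.coroot'_root_of_two_add hne.symm hne'' (hε.trans (add_comm _ _))).1
      rw [hq] at this
      norm_num at this
    · exact MinusculeSet.eq_smul_rootEnd_iff (MinusculeSet.mul_mul_eq_of_rat (R := ℂ) hmul)
    · exact Ψ.ext_xRoot R (conj_eq_mul_mul_of_right (Ψ.rootEnd_mul_self R W α)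
        (Ψ.rootEnd_mul_self R W β)
        (MinusculeSet.ActsAsRoot.mul_mul_eq_zero Ψ (Ψ.actsAsRoot_rootVector W β)
          (Ψ.actsAsRoot_rootVector W α) (by rw [hq]; norm_num))
        (MinusculeSet.lie_eq_of_rat hlie) (MinusculeSet.mul_mul_eq_of_rat hmul))
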